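/- **Setting.** $\lambda$-terms are taken up to $\alpha$-equivalence; $\simeq_\beta$ is $\beta$-equivalence, and $u \succ v$ means that $v$ is obtained from $u$ by finitely many (possibly zero) head reduction steps, a head step being $\lambda x_1\dots\lambda x_n\,(\lambda x\,u)v\,\bar w \to \lambda x_1\dots\lambda x_n\,(u[v/x])\,\bar w$. Fix a language (function symbols and predicate symbols of all arities). Types of $AF2$ are the second order formulas built from atomic formulas $R(t_1,\dots,t_n)$ ($R$ a predicate symbol; $\bot$ is a $0$-ary predicate symbol) and $X(t_1,\dots,t_n)$ ($X$ an $n$-ary predicate variable, $n\ge 0$) by $\to$, $\forall x$ (first order) and $\forall X$ (second order); $\neg A$ is $A\to\bot$. Fix a set of equations between first order terms, and let $\approx$ be the equivalence relation generated by their substitution instances. $\Gamma\vdash_{AF2} t:A$ is defined by the rules: (1) $\Gamma\vdash x_i:A_i$ for $x_i:A_i$ in $\Gamma$; (2) from $\Gamma,x:A\vdash t:B$ infer $\Gamma\vdash\lambda x\,t:A\to B$; (3) from $\Gamma\vdash u:A\to B$ and $\Gamma\vdash v:A$ infer $\Gamma\vdash (u)v:B$; (4), (6) from $\Gamma\vdash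 t:A$ infer $\Gamma\vdash t:\forall x A$, resp. $\forall X A$, if $x$, resp. $X$, is not free in $\Gamma$; (5) from $\Gamma\vdash t:\forall xA$ infer $\Gamma\vdash t:A[u/x]$ for every term $u$; (7) from $\Gamma\vdash t:\forall XA$ infer $\Gamma\vdash t:A[G/X]$ for every formula $G$; (8) from $\Gamma\vdash t:A[u/x]$ and $u\approx v$ infer $\Gamma\vdash t:A[v/x]$. The system $AF2_\bot$ has in addition, for each arity, special predicate variables $X_\bot$. An $\bot$-type is a type ending with $\bot$ or a special variable: $\bot$ and $X_\bot(\bar t)$ are $\bot$-types, and if $B$ is an $\bot$-type, so are $A\to B$ (any type $A$) and $\forall v\,B$ (any variable $v$). The rules of $AF2_\bot$ (written $\vdash_\bot$) are (1)–(8) for all formulas of the extended language, together with: from $\Gamma\vdash t:A$ infer $\Gamma\vdash t:\forall X_\bot A$ if $X_\bot$ is not free in $\Gamma$; from $\Gamma\vdash t:\forall X_\bot A$ infer $\Gamma\vdash t:A[G/X_\bot]$ for every $\bot$-type $G$. For an $AF2$ type $A$, $A^\bot$ is obtained by replacing every predicate variable $X$ (free or bound) by an associated special variable $X_\bot$ of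 the same arity, predicate symbols being unchanged. The $\forall$-positive and $\forall$-negative types of $AF2$ are defined by: atomic types are both; if $A$ is $\forall$-negative and $B$ is $\forall$-positive, then $A\to B$ is $\forall$-positive and $B\to A$ is $\forall$-negative; both classes are closed under $\forall x$; $\forall X A$ is $\forall$-positive if $A$ is; $\forall XA$ is $\forall$-negative if $A$ is and $X$ is not free in $A$. A closed $\lambda$-term $T$ is a *storage operator for the pair* $(D,E)$ of closed $AF2$ types if for every $\lambda$-term $t$ with $\vdash_{AF2}t:D$ there are $\lambda$-terms $\tau_t,\tau'_t$ with $\tau'_t\simeq_\beta\tau_t$ and $\vdash_{AF2}\tau'_t:E$, such that for every $\lambda$-term $\theta_t\simeq_\beta t$ and every variable $f$ not free in $\theta_t$ there is a substitution $\sigma$ with $(T)\theta_t f\succ (f)\sigma(\tau_t)$. **Theorem 6.1.** Let $D$, $E$ be two closed $\forall$-positive types of $AF2$ such that $E$ does not contain $\bot$, and such that no predicate symbol of the language occurs in both $D$ and $E$ (for instance, $\bot$ is the only predicate symbol of the language). If $\vdash_\bot T: D^\bot\to\neg\neg E$, then $T$ is a closed term and is a storage operator for the pair $(D,E)$. -/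

import Mathlib

universe u v

namespace StorageOp

/-! ### Pure lambda-calculus (de Bruijn indices) -/

/-- Pure lambda-terms, up to renaming of bound variables. In a term standing on its own,
`var i` is the `i`-th free variable. -/
inductive Lam : Type
  | var : ℕ → Lam
  | app : Lam → Lam → Lam
  | lam : Lam → Lam

namespace Lam

/-- A renaming of variables, extended under a binder. -/
def upRen (ρ : ℕ → ℕ) : ℕ → ℕ
  | 0 => 0
  | i + 1 => ρ i + 1

/-- Renaming of the free variables. -/
def rename : (ℕ → ℕ) → Lam → Lam
  | ρ, var i => var (ρ i)
  | ρ, app t s => app (rename ρ t) (rename ρ s)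
  | ρ, lam t => lam (rename (upRen ρ) t)

/-- A simultaneous substitution, extended under a binder. -/
def upSubst (σ : ℕ → Lam) : ℕ → Lam
  | 0 => var 0
  | i + 1 => rename Nat.succ (σ i)

/-- Capture-avoiding simultaneous substitution `σ(t)` for the free variables of `t`. -/
def subst : (ℕ → Lam) → Lam → Lam
  | σ, var i => σ i
  | σ, app t s => app (subst σ t) (subst σ s)
  | σ, lam t => lam (subst (upSubst σ) t)

/-- `t.inst s` is the contractum of `(lam t) s`. -/
def inst (t s : Lam) : Lam :=
  subst (fun i => match i with | 0 => s | j + 1 => var j) t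

/-- `t.HasFree i`: the variable `i` occurs free in `t`. -/
def HasFree : Lam → ℕ → Prop
  | var j, i => j = i
  | app t s, i => HasFree t i ∨ HasFree s i
  | lam t, i => HasFree t (i + 1)

/-- A closed term has no free variable. -/
def Closed (t : Lam) : Prop := ∀ i, ¬ t.HasFree i

/-- One step of beta-reduction, anywhere in the term. -/
inductive BetaStep : Lam → Lam → Prop
  | beta (t s : Lam) : BetaStep (app (lam t) s) (t.inst s)
  | appLeft {t t' : Lam} (s : Lam) : BetaStep t t' → BetaStep (app t s) (app t' s)
  | appRight (t : Lam) {s s' : Lam} : BetaStep s s' → BetaStep (app t s) (app t s')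
  | lam {t t' : Lam} : BetaStep t t' → BetaStep (lam t) (lam t')

/-- Beta-equivalence. -/
def BetaEq : Lam → Lam → Prop := Relation.EqvGen BetaStep

/-- Contraction of the head redex of a term `(λx u) v w₁ … wₘ`. -/
inductive SpineStep : Lam → Lam → Prop
  | beta (t s : Lam) : SpineStep (app (lam t) s) (t.inst s)
  | app {t t' : Lam} (s : Lam) : SpineStep t t' → SpineStep (app t s) (app t' s)

/-- Contraction of the head redex of a term `λx₁ … λxₙ (λx u) v w₁ … wₘ`. -/
inductive HeadStep : Lam → Lam → Prop
  | spine {t t' : Lam} : SpineStep t t' → HeadStep t t'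
  | lam {t t' : Lam} : HeadStep t t' → HeadStep (lam t) (lam t')

/-- Finitely many (possibly zero) head reduction steps. -/
def HeadRed : Lam → Lam → Prop := Relation.ReflTransGen HeadStep

end Lam

/-! ### Second order formulas

First order terms over the language `L` are `L.Term ℕ`. Both first order and second order
variables are de Bruijn indices. Second order variables come in several sorts, the elements of
`K`, and for each sort `k` and each arity `n` there is a separate numbering of the variables of
sort `k` and arity `n`. The predicate symbols of the language are `⊥` and the `L.Relations n`. -/

inductive Formula (L : FirstOrder.Language.{u, v}) (K : Type) : Type (max u v)
  | bot : Formula L K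
  | rel : (n : ℕ) → L.Relations n → (Fin n → L.Term ℕ) → Formula L K
  | pvar : (k : K) → (n : ℕ) → ℕ → (Fin n → L.Term ℕ) → Formula L K
  | imp : Formula L K → Formula L K → Formula L K
  | all₁ : Formula L K → Formula L K
  | all₂ : (k : K) → (n : ℕ) → Formula L K → Formula L K

namespace Formula

variable {L : FirstOrder.Language.{u, v}} {K : Type}

/-- `¬ A` is `A → ⊥`. -/
def neg (A : Formula L K) : Formula L K := imp A bot

/-- A first order substitution, extended under a first order binder. -/
def upSubst₁ (σ : ℕ → L.Term ℕ) : ℕ → L.Term ℕ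
  | 0 => FirstOrder.Language.Term.var 0
  | i + 1 => (σ i).relabel Nat.succ

/-- Simultaneous substitution of terms for the free first order variables. -/
def subst₁ : (ℕ → L.Term ℕ) → Formula L K → Formula L K
  | _, bot => bot
  | σ, rel n R ts => rel n R (fun j => (ts j).subst σ)
  | σ, pvar k n i ts => pvar k n i (fun j => (ts j).subst σ)
  | σ, imp A B => imp (subst₁ σ A) (subst₁ σ B)
  | σ, all₁ A => all₁ (subst₁ (upSubst₁ σ) A)
  | σ, all₂ k n A => all₂ k n (subst₁ σ A)

/-- Weakening by a new first order variable, which gets the index `0`. -/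
def shift₁ (A : Formula L K) : Formula L K :=
  subst₁ (fun i => FirstOrder.Language.Term.var (i + 1)) A

/-- `A.inst₁ a` is `A[a/x]`, where `x` is the variable of index `0`. -/
def inst₁ (A : Formula L K) (a : L.Term ℕ) : Formula L K :=
  subst₁ (fun i => match i with | 0 => a | j + 1 => FirstOrder.Language.Term.var j) A

section SecondOrder

variable [DecidableEq K]

/-- A renaming of second order variables, extended under a binder of sort `k` and arity `n`. -/
def upRen₂ (k : K) (n : ℕ) (ρ : K → ℕ → ℕ → ℕ) (k' : K) (n' : ℕ) (i : ℕ) : ℕ :=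
  if k' = k ∧ n' = n then (match i with | 0 => 0 | j + 1 => ρ k' n' j + 1) else ρ k' n' i

/-- Renaming of the free second order variables. -/
def rename₂ : (K → ℕ → ℕ → ℕ) → Formula L K → Formula L K
  | _, bot => bot
  | _, rel n R ts => rel n R ts
  | ρ, pvar k n i ts => pvar k n (ρ k n i) ts
  | ρ, imp A B => imp (rename₂ ρ A) (rename₂ ρ B)
  | ρ, all₁ A => all₁ (rename₂ ρ A)
  | ρ, all₂ k n A => all₂ k n (rename₂ (upRen₂ k n ρ) A)

/-- Weakening by a new second order variable of sort `k` and arity `n`, which gets the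
index `0`. -/
def shift₂ (k : K) (n : ℕ) (A : Formula L K) : Formula L K :=
  rename₂ (fun k' n' i => if k' = k ∧ n' = n then i + 1 else i) A

/-- The atomic formula `X(x₁, …, xₙ)`, where the `n` parameters `x₁, …, xₙ` are the first order
variables of indices `0, …, n - 1`. -/
def generic (k : K) (n i : ℕ) : Formula L K :=
  pvar k n i (fun j => FirstOrder.Language.Term.var (j : ℕ))

/-- A second order substitution, extended under a second order binder. -/
def upSubst₂ (k : K) (n : ℕ) (σ : K → ℕ → ℕ → Formula L K) (k' : K) (n' : ℕ) (i : ℕ) :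
    Formula L K :=
  if k' = k ∧ n' = n then
    (match i with | 0 => generic k' n' 0 | j + 1 => shift₂ k n (σ k' n' j))
  else shift₂ k n (σ k' n' i)

/-- The first order substitution of `ts` for the `n` parameters of indices `0, …, n - 1`; the
variable of index `n + j` becomes the variable of index `j`. -/
def args {n : ℕ} (ts : Fin n → L.Term ℕ) (j : ℕ) : L.Term ℕ :=
  if h : j < n then ts ⟨j, h⟩ else FirstOrder.Language.Term.var (j - n)

/-- Simultaneous substitution of formulas for the free second order variables. The formula
`σ k n i` has as parameters its first order variables of indices `0, …, n - 1`, and its variable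
of index `n + j` stands for the ambient first order variable `j`: the atom `X(t₁, …, tₙ)` with
`X` the variable `i` of sort `k` becomes `(σ k n i)[t₁/x₁, …, tₙ/xₙ]`. -/
def subst₂ : (K → ℕ → ℕ → Formula L K) → Formula L K → Formula L K
  | _, bot => bot
  | _, rel n R ts => rel n R ts
  | σ, pvar k n i ts => subst₁ (args ts) (σ k n i)
  | σ, imp A B => imp (subst₂ σ A) (subst₂ σ B)
  | σ, all₁ A =>
      all₁ (subst₂ (fun k n i => subst₁
        (fun j => FirstOrder.Language.Term.var (if j < n then j else j + 1)) (σ k n i)) A)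
  | σ, all₂ k n A => all₂ k n (subst₂ (upSubst₂ k n σ) A)

/-- `A.inst₂ k n G` is `A[G/X]`, where `X` is the variable of sort `k`, arity `n` and index `0`,
and the `n` parameters of `G` are its first order variables of indices `0, …, n - 1`. -/
def inst₂ (k : K) (n : ℕ) (A G : Formula L K) : Formula L K :=
  subst₂ (fun k' n' i =>
    if k' = k ∧ n' = n then (match i with | 0 => G | j + 1 => generic k' n' j)
    else generic k' n' i) A

/-- The second order variable `i` of sort `k` and arity `n` occurs free in the formula. -/
def HasFree₂ (k : K) (n : ℕ) : Formula L K → ℕ → Prop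
  | bot, _ => False
  | rel _ _ _, _ => False
  | pvar k' n' j _, i => k' = k ∧ n' = n ∧ j = i
  | imp A B, i => HasFree₂ k n A i ∨ HasFree₂ k n B i
  | all₁ A, i => HasFree₂ k n A i
  | all₂ k' n' A, i => HasFree₂ k n A (if k' = k ∧ n' = n then i + 1 else i)

end SecondOrder

/-- The first order variable `i` occurs free in the formula. -/
def HasFree₁ : Formula L K → ℕ → Prop
  | bot, _ => False
  | rel _ _ ts, i => ∃ j, i ∈ (ts j).varFinset
  | pvar _ _ _ ts, i => ∃ j, i ∈ (ts j).varFinset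
  | imp A B, i => HasFree₁ A i ∨ HasFree₁ B i
  | all₁ A, i => HasFree₁ A (i + 1)
  | all₂ _ _ A, i => HasFree₁ A i

/-- A closed formula has no free variable, of first or second order. -/
def Closed [DecidableEq K] (A : Formula L K) : Prop :=
  (∀ i, ¬ A.HasFree₁ i) ∧ ∀ k n i, ¬ A.HasFree₂ k n i

/-- The symbol `⊥` occurs in the formula. -/
def HasBot : Formula L K → Prop
  | bot => True
  | rel _ _ _ => False
  | pvar _ _ _ _ => False
  | imp A B => HasBot A ∨ HasBot B
  | all₁ A => HasBot A
  | all₂ _ _ A => HasBot A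

/-- The predicate symbol `R` of the language occurs in the formula. -/
def HasRel {n : ℕ} (R : L.Relations n) : Formula L K → Prop
  | bot => False
  | rel m S _ => (⟨m, S⟩ : Σ m, L.Relations m) = ⟨n, R⟩
  | pvar _ _ _ _ => False
  | imp A B => HasRel R A ∨ HasRel R B
  | all₁ A => HasRel R A
  | all₂ _ _ A => HasRel R A

/-- Changing the sorts of all second order variables, free or bound. -/
def mapSort {K' : Type} (φ : K → K') : Formula L K → Formula L K'
  | bot => bot
  | rel n R ts => rel n R ts
  | pvar k n i ts => pvar (φ k) n i ts
  | imp A B => imp (mapSort φ A) (mapSort φ B)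
  | all₁ A => all₁ (mapSort φ A)
  | all₂ k n A => all₂ (φ k) n (mapSort φ A)

end Formula

/-- The types of `AF2`: there is one sort of second order variables. -/
abbrev AF2Type (L : FirstOrder.Language.{u, v}) : Type (max u v) := Formula L Unit

/-- The two sorts of second order variables of the extended system: the ordinary variables `X`
and the special variables `X_⊥`. -/
inductive VarSort : Type
  | ordinary : VarSort
  | special : VarSort
  deriving DecidableEq

/-- The types of the extended system `AF2_⊥`. -/
abbrev ExtType (L : FirstOrder.Language.{u, v}) : Type (max u v) := Formula L VarSort

variable {L : FirstOrder.Language.{u, v}}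

/-- The `⊥`-types: those ending with `⊥` or with a special variable. -/
def IsBotType : ExtType L → Prop
  | .bot => True
  | .rel _ _ _ => False
  | .pvar k _ _ _ => k = VarSort.special
  | .imp _ B => IsBotType B
  | .all₁ A => IsBotType A
  | .all₂ _ _ A => IsBotType A

/-- An `AF2` type, seen as a type of the extended system. -/
def AF2Type.toExt (A : AF2Type L) : ExtType L := A.mapSort (fun _ => VarSort.ordinary)

/-- The translation `A ↦ A^⊥`: every second order variable `X` is replaced by the associated
special variable `X_⊥`, predicate symbols are left unchanged. -/
def AF2Type.perp (A : AF2Type L) : ExtType L := A.mapSort (fun _ => VarSort.special)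

mutual
/-- The `∀`-positive types. -/
def ForallPositive : AF2Type L → Prop
  | .bot => True
  | .rel _ _ _ => True
  | .pvar _ _ _ _ => True
  | .imp A B => ForallNegative A ∧ ForallPositive B
  | .all₁ A => ForallPositive A
  | .all₂ _ _ A => ForallPositive A
/-- The `∀`-negative types. -/
def ForallNegative : AF2Type L → Prop
  | .bot => True
  | .rel _ _ _ => True
  | .pvar _ _ _ _ => True
  | .imp A B => ForallPositive A ∧ ForallNegative B
  | .all₁ A => ForallNegative A
  | .all₂ k n A => ForallNegative A ∧ ¬ A.HasFree₂ k n 0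
end

/-! ### The type systems -/

/-- The relation `a ≈ b` of a set of equations: the equivalence relation generated by the
substitution instances of the equations. -/
def Approx (Eqs : Set (L.Term ℕ × L.Term ℕ)) : L.Term ℕ → L.Term ℕ → Prop :=
  Relation.EqvGen (fun a b => ∃ p ∈ Eqs, ∃ s : ℕ → L.Term ℕ, a = p.1.subst s ∧ b = p.2.subst s)

/-- The typing rules `Γ ⊢ t : A` with respect to a set of equations. The `i`-th formula of `Γ` is
the type of the variable `i`. A second order variable of sort `k` may be instantiated
by the formulas `G` with `adm k G`. -/
inductive Typing {K : Type} [DecidableEq K] (Eqs : Set (L.Term ℕ × L.Term ℕ))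
    (adm : K → Formula L K → Prop) : List (Formula L K) → Lam → Formula L K → Prop
  | var {Γ : List (Formula L K)} {i : ℕ} {A : Formula L K} :
      Γ[i]? = some A → Typing Eqs adm Γ (.var i) A
  | lam {Γ : List (Formula L K)} {t : Lam} {A B : Formula L K} :
      Typing Eqs adm (A :: Γ) t B → Typing Eqs adm Γ (.lam t) (.imp A B)
  | app {Γ : List (Formula L K)} {t s : Lam} {A B : Formula L K} :
      Typing Eqs adm Γ t (.imp A B) → Typing Eqs adm Γ s A → Typing Eqs adm Γ (.app t s) B
  | all₁Intro {Γ : List (Formula L K)} {t : Lam} {A : Formula L K} :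
      Typing Eqs adm (Γ.map Formula.shift₁) t A → Typing Eqs adm Γ t (.all₁ A)
  | all₁Elim {Γ : List (Formula L K)} {t : Lam} {A : Formula L K} (a : L.Term ℕ) :
      Typing Eqs adm Γ t (.all₁ A) → Typing Eqs adm Γ t (A.inst₁ a)
  | all₂Intro {Γ : List (Formula L K)} {t : Lam} {k : K} {n : ℕ} {A : Formula L K} :
      Typing Eqs adm (Γ.map (Formula.shift₂ k n)) t A → Typing Eqs adm Γ t (.all₂ k n A)
  | all₂Elim {Γ : List (Formula L K)} {t : Lam} {k : K} {n : ℕ} {A : Formula L K}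
      (G : Formula L K) :
      adm k G → Typing Eqs adm Γ t (.all₂ k n A) → Typing Eqs adm Γ t (A.inst₂ k n G)
  | eq {Γ : List (Formula L K)} {t : Lam} (A : Formula L K) {a b : L.Term ℕ} :
      Approx Eqs a b → Typing Eqs adm Γ t (A.inst₁ a) → Typing Eqs adm Γ t (A.inst₁ b)

/-- Typing in `AF2`: every formula may be substituted for a second order variable. -/
def TypingAF2 (Eqs : Set (L.Term ℕ × L.Term ℕ)) : List (AF2Type L) → Lam → AF2Type L → Prop :=
  Typing Eqs (fun _ _ => True)

/-- Typing in `AF2_⊥`: every formula may be substituted for an ordinary variable, and every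
`⊥`-type for a special variable. -/
def TypingExt (Eqs : Set (L.Term ℕ × L.Term ℕ)) : List (ExtType L) → Lam → ExtType L → Prop :=
  Typing Eqs (fun k G => k = VarSort.special → IsBotType G)

/-- `T` is a storage operator for the pair of types `(D, E)`: it is closed, and for every `t`
of type `D` there are `τ` and `τ' ≃ τ` of type `E` such that for every `θ ≃ t` and
every variable `f` not free in `θ`, there is a substitution `σ` with `(T) θ f ≻ (f) σ(τ)`. -/
def IsStorageOperator (Eqs : Set (L.Term ℕ × L.Term ℕ)) (T : Lam) (D E : AF2Type L) : Prop :=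
  T.Closed ∧
  ∀ t : Lam, TypingAF2 Eqs [] t D →
    ∃ τ τ' : Lam, Lam.BetaEq τ' τ ∧ TypingAF2 Eqs [] τ' E ∧
      ∀ θ : Lam, Lam.BetaEq θ t → ∀ f : ℕ, ¬ θ.HasFree f →
        ∃ σ : ℕ → Lam,
          Lam.HeadRed (.app (.app T θ) (.var f)) (.app (.var f) (Lam.subst σ τ))

end StorageOp

/-!
The proof is by realizability. Each formula is interpreted by a set of lambda-terms with constants
(`Model.Sem`), and typed terms realize their types (`Model.adequacy`). The interpretations have two
peculiarities.

*Uniformity.* All the terms `θ ≃ t` and all the variables `f` are treated at once: they are the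
indices `I` of families of pure terms, and these families are the constants of the calculus
`Tm (I → Lam)`. In `famModel`, a type ending with `⊥` or with a special variable is interpreted by a
set of families, closed under weak head expansion in each component, while the realizers of the other
types are single terms with constants. Hence a realizer of `⊥` which has the form `f e` gives at once
all the terms `f σ(τ)`: the term `τ` is `e` with variables for its constants, and `σ` puts the
components of the families back.

*Typing.* The argument of a realizer of `A → B` has to be a realizer of `A` which comes
from a term of type `A` by replacing variables of types ending with `⊥` by constants (`ConstTyping`).
So the argument `e` of `f` above comes from a term `τ` of type `E` in such a context. By a second
interpretation, in which all terms realize the types ending with `⊥` (`pureModel`), `τ` reduces to a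
term without these variables, because `E` is `∀`-positive. By subject reduction
(`Typing.betaRed`) the latter is a closed term of type `E` (`exists_closed_typing`).

It remains that the family of the terms `θ` realizes `D^⊥` (`famModel_mem_perp`). Here `AF2` is
interpreted in a third way (`convModel`): a predicate variable stands for the terms `u` such that every
family of terms equivalent to `u` belongs to a given set of families. By induction on `∀`-positive and
`∀`-negative types (`convModel_positive_negative`), this extends to `D`. The case of the negative
implications needs that weak head reduction of a term equivalent to `c u₁ … uₙ`, with a constant `c`
in head position, reaches a term `c v₁ … vₙ` with `vᵢ` equivalent to `uᵢ` (`Tm.Rigid.conv_app`), which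
follows from confluence and standardization.
-/

namespace StorageOp

/-! ### Substitution in the pure calculus -/

/-- The sequence `a, f 0, f 1, …`. -/
def scons {α : Type*} (a : α) (f : ℕ → α) : ℕ → α
  | 0 => a
  | i + 1 => f i

theorem reflTransGen_map {α β : Type*} {r : α → α → Prop} {p : β → β → Prop} (f : α → β)
    (hf : ∀ a b, r a b → p (f a) (f b)) {a b : α} (h : Relation.ReflTransGen r a b) :
    Relation.ReflTransGen p (f a) (f b) :=
  Relation.ReflTransGen.lift f hf _ _ h

theorem eqvGen_map {α β : Type*} {r : α → α → Prop} {p : β → β → Prop} (f : α → β)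
    (hf : ∀ a b, r a b → p (f a) (f b)) {a b : α} (h : Relation.EqvGen r a b) :
    Relation.EqvGen p (f a) (f b) := by
  induction h with
  | rel _ _ h => exact .rel _ _ (hf _ _ h)
  | refl _ => exact .refl _
  | symm _ _ _ ih => exact .symm _ _ ih
  | trans _ _ _ _ _ ih₁ ih₂ => exact .trans _ _ _ ih₁ ih₂

namespace Lam

theorem rename_rename (ρ ρ' : ℕ → ℕ) (t : Lam) :
    rename ρ (rename ρ' t) = rename (fun i => ρ (ρ' i)) t := by
  induction t generalizing ρ ρ' with
  | var i => rfl
  | app t s iht ihs => simp only [rename, iht, ihs]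
  | lam t ih =>
    simp only [rename, ih]
    congr 2
    funext i; cases i <;> rfl

theorem subst_rename (σ : ℕ → Lam) (ρ : ℕ → ℕ) (t : Lam) :
    subst σ (rename ρ t) = subst (fun i => σ (ρ i)) t := by
  induction t generalizing σ ρ with
  | var i => rfl
  | app t s iht ihs => simp only [rename, subst, iht, ihs]
  | lam t ih =>
    simp only [rename, subst, ih]
    congr 2
    funext i; cases i <;> rfl

theorem rename_subst (ρ : ℕ → ℕ) (σ : ℕ → Lam) (t : Lam) :
    rename ρ (subst σ t) = subst (fun i => rename ρ (σ i)) t := by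
  induction t generalizing σ ρ with
  | var i => rfl
  | app t s iht ihs => simp only [rename, subst, iht, ihs]
  | lam t ih =>
    simp only [rename, subst, ih]
    congr 2
    funext i
    cases i with
    | zero => rfl
    | succ i => simp only [upSubst, rename_rename]; rfl

theorem subst_var (t : Lam) : subst var t = t := by
  induction t with
  | var i => rfl
  | app t s iht ihs => simp only [subst, iht, ihs]
  | lam t ih =>
    have h : upSubst var = var := by funext i; cases i <;> rfl
    simp only [subst, h, ih]

theorem inst_eq_subst (t s : Lam) : t.inst s = subst (scons s var) t := by
  unfold inst
  congr 1

theorem inst_rename_succ (t s : Lam) : (rename Nat.succ t).inst s = t := by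
  rw [inst_eq_subst, subst_rename]
  exact subst_var t

end Lam

/-! ### Lambda-terms with constants -/

/-- Lambda-terms with inert constants from `C`. -/
inductive Tm (C : Type) : Type
  | var : ℕ → Tm C
  | const : C → Tm C
  | app : Tm C → Tm C → Tm C
  | lam : Tm C → Tm C

/-- A pure term, seen as a term without constants. -/
def Lam.toTm {C : Type} : Lam → Tm C
  | .var i => .var i
  | .app t s => .app (toTm t) (toTm s)
  | .lam t => .lam (toTm t)

namespace Tm

variable {C : Type}

/-- Renaming of the free variables. -/
def rename : (ℕ → ℕ) → Tm C → Tm C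
  | ρ, var i => var (ρ i)
  | _, const c => const c
  | ρ, app t s => app (rename ρ t) (rename ρ s)
  | ρ, lam t => lam (rename (Lam.upRen ρ) t)

/-- A simultaneous substitution, extended under a binder. -/
def upSubst (σ : ℕ → Tm C) : ℕ → Tm C :=
  scons (var 0) fun i => rename Nat.succ (σ i)

/-- Capture-avoiding simultaneous substitution for the free variables. -/
def subst : (ℕ → Tm C) → Tm C → Tm C
  | σ, var i => σ i
  | _, const c => const c
  | σ, app t s => app (subst σ t) (subst σ s)
  | σ, lam t => lam (subst (upSubst σ) t)

/-- `t.inst s` is the contractum of `(lam t) s`. -/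
def inst (t s : Tm C) : Tm C := subst (scons s var) t

theorem rename_rename (ρ ρ' : ℕ → ℕ) (t : Tm C) :
    rename ρ (rename ρ' t) = rename (fun i => ρ (ρ' i)) t := by
  induction t generalizing ρ ρ' with
  | var i => rfl
  | const c => rfl
  | app t s iht ihs => simp only [rename, iht, ihs]
  | lam t ih =>
    simp only [rename, ih]
    congr 2
    funext i; cases i <;> rfl

theorem subst_rename (σ : ℕ → Tm C) (ρ : ℕ → ℕ) (t : Tm C) :
    subst σ (rename ρ t) = subst (fun i => σ (ρ i)) t := by
  induction t generalizing σ ρ with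
  | var i => rfl
  | const c => rfl
  | app t s iht ihs => simp only [rename, subst, iht, ihs]
  | lam t ih =>
    simp only [rename, subst, ih]
    congr 2
    funext i; cases i <;> rfl

theorem rename_subst (ρ : ℕ → ℕ) (σ : ℕ → Tm C) (t : Tm C) :
    rename ρ (subst σ t) = subst (fun i => rename ρ (σ i)) t := by
  induction t generalizing σ ρ with
  | var i => rfl
  | const c => rfl
  | app t s iht ihs => simp only [rename, subst, iht, ihs]
  | lam t ih =>
    simp only [rename, subst, ih]
    congr 2
    funext i
    cases i with
    | zero => rfl
    | succ i => simp only [upSubst, scons, rename_rename]; rfl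

theorem subst_var (t : Tm C) : subst var t = t := by
  induction t with
  | var i => rfl
  | const c => rfl
  | app t s iht ihs => simp only [subst, iht, ihs]
  | lam t ih =>
    have h : upSubst (var : ℕ → Tm C) = var := by funext i; cases i <;> rfl
    simp only [subst, h, ih]

theorem rename_eq_subst (ρ : ℕ → ℕ) (t : Tm C) : rename ρ t = subst (fun i => var (ρ i)) t := by
  conv_lhs => rw [← subst_var t]
  rw [rename_subst]
  rfl

theorem subst_subst (σ τ : ℕ → Tm C) (t : Tm C) :
    subst σ (subst τ t) = subst (fun i => subst σ (τ i)) t := by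
  induction t generalizing σ τ with
  | var i => rfl
  | const c => rfl
  | app t s iht ihs => simp only [subst, iht, ihs]
  | lam t ih =>
    simp only [subst, ih]
    congr 2
    funext i
    cases i with
    | zero => rfl
    | succ i => simp only [upSubst, scons, subst_rename, rename_subst]

theorem subst_inst (σ : ℕ → Tm C) (t s : Tm C) :
    subst σ (t.inst s) = (subst (upSubst σ) t).inst (subst σ s) := by
  simp only [inst, subst_subst]
  congr 1
  funext i
  cases i with
  | zero => rfl
  | succ i => simp only [upSubst, scons, subst, subst_rename, subst_var]

theorem rename_inst (ρ : ℕ → ℕ) (t s : Tm C) :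
    rename ρ (t.inst s) = (rename (Lam.upRen ρ) t).inst (rename ρ s) := by
  simp only [inst, rename_subst, subst_rename]
  congr 1
  funext i; cases i <;> rfl

theorem subst_upSubst_inst (σ : ℕ → Tm C) (t s : Tm C) :
    (subst (upSubst σ) t).inst s = subst (scons s σ) t := by
  simp only [inst, subst_subst]
  congr 1
  funext i
  cases i with
  | zero => rfl
  | succ i => simp only [upSubst, scons, subst_rename, subst_var]

/-- Replacement of the constants by pure terms; the variables bound in the ambient term are
avoided by the pure terms. -/
def eval : (C → Lam) → Tm C → Lam
  | _, var i => .var i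
  | g, const c => g c
  | g, app t s => .app (eval g t) (eval g s)
  | g, lam t => .lam (eval (fun c => Lam.rename Nat.succ (g c)) t)

theorem eval_rename (g : C → Lam) (ρ : ℕ → ℕ) (t : Tm C) :
    eval (fun c => Lam.rename ρ (g c)) (rename ρ t) = Lam.rename ρ (eval g t) := by
  induction t generalizing g ρ with
  | var i => rfl
  | const c => rfl
  | app t s iht ihs => simp only [rename, eval, Lam.rename, iht, ihs]
  | lam t ih =>
    simp only [rename, eval, Lam.rename, ← ih, Lam.rename_rename]
    rfl

theorem eval_subst {g g' : C → Lam} {σ : ℕ → Tm C} {τ : ℕ → Lam}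
    (hg : ∀ c, Lam.subst τ (g' c) = g c) (hσ : ∀ i, eval g (σ i) = τ i) (t : Tm C) :
    eval g (subst σ t) = Lam.subst τ (eval g' t) := by
  induction t generalizing g g' σ τ with
  | var i => exact hσ i
  | const c => exact (hg c).symm
  | app t s iht ihs => simp only [subst, eval, Lam.subst, iht hg hσ, ihs hg hσ]
  | lam t ih =>
    simp only [subst, eval, Lam.subst]
    congr 1
    refine ih (fun c => ?_) (fun i => ?_)
    · rw [← hg c, Lam.subst_rename, Lam.rename_subst]; rfl
    · cases i with
      | zero => rfl
      | succ i => exact (eval_rename g Nat.succ (σ i)).trans (by rw [hσ]; rfl)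

theorem eval_inst (g : C → Lam) (t s : Tm C) :
    eval g (t.inst s) = (eval (fun c => Lam.rename Nat.succ (g c)) t).inst (eval g s) := by
  rw [Lam.inst_eq_subst]
  refine eval_subst (fun c => ?_) (fun i => ?_) t
  · rw [← Lam.inst_eq_subst, Lam.inst_rename_succ]
  · cases i <;> rfl

theorem eval_subst_toTm (g : C → Lam) (σ : ℕ → Tm C) (t : Lam) :
    eval g (subst σ t.toTm) = Lam.subst (fun i => eval g (σ i)) t := by
  induction t generalizing g σ with
  | var i => rfl
  | app t s iht ihs => simp only [Lam.toTm, subst, eval, Lam.subst, iht, ihs]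
  | lam t ih =>
    simp only [Lam.toTm, subst, eval, Lam.subst, ih]
    congr 2
    funext i
    cases i with
    | zero => rfl
    | succ i => exact eval_rename g Nat.succ (σ i)

theorem eval_toTm (g : C → Lam) (t : Lam) : eval g t.toTm = t := by
  rw [← subst_var t.toTm, eval_subst_toTm]
  exact Lam.subst_var t

theorem toTm_rename (ρ : ℕ → ℕ) (t : Lam) :
    (Lam.rename ρ t).toTm = rename ρ (t.toTm : Tm C) := by
  induction t generalizing ρ with
  | var i => rfl
  | app t s iht ihs => simp only [Lam.rename, Lam.toTm, rename, iht, ihs]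
  | lam t ih => simp only [Lam.rename, Lam.toTm, rename, ih]

theorem toTm_subst (σ : ℕ → Lam) (t : Lam) :
    (Lam.subst σ t).toTm = subst (fun i => ((σ i).toTm : Tm C)) t.toTm := by
  induction t generalizing σ with
  | var i => rfl
  | app t s iht ihs => simp only [Lam.subst, Lam.toTm, subst, iht, ihs]
  | lam t ih =>
    simp only [Lam.subst, Lam.toTm, subst, ih]
    congr 2
    funext i
    cases i with
    | zero => rfl
    | succ i => exact toTm_rename Nat.succ (σ i)

theorem toTm_inst (t s : Lam) : (t.inst s).toTm = (t.toTm : Tm C).inst s.toTm := by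
  rw [Lam.inst_eq_subst, toTm_subst, inst]
  congr 1
  funext i; cases i <;> rfl

/-- Substitution into a pure term depends only on its free variables. -/
theorem subst_toTm_congr {σ τ : ℕ → Tm C} (t : Lam) (h : ∀ i, t.HasFree i → σ i = τ i) :
    subst σ t.toTm = subst τ t.toTm := by
  induction t generalizing σ τ with
  | var i => exact h i rfl
  | app t s iht ihs =>
    simp only [Lam.toTm, subst, iht fun i hi => h i (Or.inl hi), ihs fun i hi => h i (Or.inr hi)]
  | lam t ih =>
    simp only [Lam.toTm, subst]
    congr 1
    refine ih fun i hi => ?_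
    cases i with
    | zero => rfl
    | succ i => simp only [upSubst, scons, h i hi]

/-! ### Reduction -/

/-- One step of beta-reduction, anywhere in the term. -/
inductive Step : Tm C → Tm C → Prop
  | beta (t s : Tm C) : Step (app (lam t) s) (t.inst s)
  | appLeft {t t' : Tm C} (s : Tm C) : Step t t' → Step (app t s) (app t' s)
  | appRight (t : Tm C) {s s' : Tm C} : Step s s' → Step (app t s) (app t s')
  | lam {t t' : Tm C} : Step t t' → Step (lam t) (lam t')

/-- Contraction of the head redex of a term `(λx u) v w₁ … wₘ`. -/
inductive Spine : Tm C → Tm C → Prop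
  | beta (t s : Tm C) : Spine (app (lam t) s) (t.inst s)
  | app {t t' : Tm C} (s : Tm C) : Spine t t' → Spine (app t s) (app t' s)

/-- Finitely many steps of beta-reduction. -/
abbrev Red : Tm C → Tm C → Prop := Relation.ReflTransGen Step

/-- Finitely many steps of weak head reduction. -/
abbrev SpineRed : Tm C → Tm C → Prop := Relation.ReflTransGen Spine

/-- Beta-equivalence. -/
abbrev Conv : Tm C → Tm C → Prop := Relation.EqvGen Step

theorem Spine.step {t t' : Tm C} (h : Spine t t') : Step t t' := by
  induction h with
  | beta t s => exact .beta t s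
  | app s _ ih => exact .appLeft s ih

theorem SpineRed.app {t t' : Tm C} (s : Tm C) (h : SpineRed t t') :
    SpineRed (app t s) (app t' s) :=
  reflTransGen_map (fun t => Tm.app t s) (fun _ _ h => .app s h) h

theorem SpineRed.red {t t' : Tm C} (h : SpineRed t t') : Red t t' :=
  reflTransGen_map id (fun _ _ h => h.step) h

theorem Red.app {t t' s s' : Tm C} (ht : Red t t') (hs : Red s s') :
    Red (app t s) (app t' s') :=
  (reflTransGen_map (fun t => Tm.app t s) (fun _ _ h => Step.appLeft s h) ht).trans
    (reflTransGen_map (fun s => Tm.app t' s) (fun _ _ h => Step.appRight t' h) hs)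

theorem Red.lam {t t' : Tm C} (ht : Red t t') : Red (lam t) (lam t') :=
  reflTransGen_map Tm.lam (fun _ _ h => Step.lam h) ht

theorem Red.conv {t t' : Tm C} (h : Red t t') : Conv t t' :=
  Relation.EqvGen.reflTransGen_le_eqvGen _ _ _ h

theorem Conv.appLeft {t t' : Tm C} (s : Tm C) (h : Conv t t') : Conv (app t s) (app t' s) :=
  eqvGen_map (fun t => Tm.app t s) (fun _ _ h => Step.appLeft s h) h

theorem Spine.rename {t t' : Tm C} (h : Spine t t') (ρ : ℕ → ℕ) :
    Spine (rename ρ t) (rename ρ t') := by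
  induction h generalizing ρ with
  | beta t s => rw [rename_inst]; exact .beta _ _
  | app s _ ih => exact .app _ (ih ρ)

theorem Spine.subst {t t' : Tm C} (h : Spine t t') (σ : ℕ → Tm C) :
    Spine (subst σ t) (subst σ t') := by
  induction h generalizing σ with
  | beta t s => rw [subst_inst]; exact .beta _ _
  | app s _ ih => exact .app _ (ih σ)

theorem Spine.eval {t t' : Tm C} (h : Spine t t') (g : C → Lam) :
    Lam.SpineStep (eval g t) (eval g t') := by
  induction h with
  | beta t s => rw [eval_inst]; exact .beta _ _
  | app s _ ih => exact .app _ ih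

theorem Step.eval {t t' : Tm C} (h : Step t t') (g : C → Lam) :
    Lam.BetaStep (eval g t) (eval g t') := by
  induction h generalizing g with
  | beta t s => rw [eval_inst]; exact .beta _ _
  | appLeft s _ ih => exact .appLeft _ (ih g)
  | appRight s _ ih => exact .appRight _ (ih g)
  | lam _ ih => exact .lam (ih _)

theorem Step.toTm {t t' : Lam} (h : t.BetaStep t') : Step (t.toTm : Tm C) t'.toTm := by
  induction h with
  | beta t s => rw [toTm_inst]; exact .beta _ _
  | appLeft s _ ih => exact .appLeft _ ih
  | appRight s _ ih => exact .appRight _ ih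
  | lam _ ih => exact .lam ih

theorem Conv.toTm {t t' : Lam} (h : t.BetaEq t') : Conv (t.toTm : Tm C) t'.toTm :=
  eqvGen_map Lam.toTm (fun _ _ h => Step.toTm h) h

/-- Beta-steps of a renamed term come from beta-steps of the term, even if the renaming is not
injective. -/
theorem Step.of_rename {ρ : ℕ → ℕ} {t v : Tm C} (h : Step (Tm.rename ρ t) v) :
    ∃ t', Step t t' ∧ v = Tm.rename ρ t' := by
  induction t generalizing ρ v with
  | var i => cases h
  | const c => cases h
  | lam t ih =>
    cases h with
    | lam h =>
      obtain ⟨t', h', rfl⟩ := ih h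
      exact ⟨_, .lam h', rfl⟩
  | app t s iht ihs =>
    simp only [Tm.rename] at h
    generalize ht : Tm.rename ρ t = t₁ at h
    cases h with
    | appLeft _ h =>
      obtain ⟨t', h', rfl⟩ := iht (ht ▸ h)
      exact ⟨_, .appLeft _ h', rfl⟩
    | appRight _ h =>
      obtain ⟨s', h', rfl⟩ := ihs h
      exact ⟨_, .appRight _ h', by rw [← ht]; rfl⟩
    | beta t₂ _ =>
      cases t with
      | lam t =>
        cases ht
        exact ⟨_, .beta t s, (rename_inst ρ t s).symm⟩
      | _ => cases ht

theorem Red.of_rename {ρ : ℕ → ℕ} {t v : Tm C} (h : Red (Tm.rename ρ t) v) :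
    ∃ t', Red t t' ∧ v = Tm.rename ρ t' := by
  induction h with
  | refl => exact ⟨t, .refl, rfl⟩
  | tail _ h ih =>
    obtain ⟨t', h', rfl⟩ := ih
    obtain ⟨t'', h'', rfl⟩ := h.of_rename
    exact ⟨t'', h'.tail h'', rfl⟩

/-! ### Confluence -/

/-- Parallel reduction. -/
inductive Par : Tm C → Tm C → Prop
  | var (i : ℕ) : Par (var i) (var i)
  | const (c : C) : Par (const c) (const c)
  | app {t t' s s' : Tm C} : Par t t' → Par s s' → Par (app t s) (app t' s')
  | lam {t t' : Tm C} : Par t t' → Par (lam t) (lam t')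
  | beta {t t' s s' : Tm C} : Par t t' → Par s s' → Par (app (lam t) s) (t'.inst s')

theorem Par.refl (t : Tm C) : Par t t := by
  induction t with
  | var i => exact .var i
  | const c => exact .const c
  | app _ _ iht ihs => exact .app iht ihs
  | lam _ ih => exact .lam ih

theorem Par.of_step {t t' : Tm C} (h : Step t t') : Par t t' := by
  induction h with
  | beta t s => exact .beta (.refl t) (.refl s)
  | appLeft s _ ih => exact .app ih (.refl s)
  | appRight t _ ih => exact .app (.refl t) ih
  | lam _ ih => exact .lam ih

theorem Par.red {t t' : Tm C} (h : Par t t') : Red t t' := by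
  induction h with
  | var i => exact .refl
  | const c => exact .refl
  | app _ _ iht ihs => exact iht.app ihs
  | lam _ ih => exact ih.lam
  | beta _ _ iht ihs => exact (iht.lam.app ihs).tail (.beta _ _)

theorem Par.rename {t t' : Tm C} (h : Par t t') (ρ : ℕ → ℕ) :
    Par (rename ρ t) (rename ρ t') := by
  induction h generalizing ρ with
  | var i => exact .var _
  | const c => exact .const c
  | app _ _ iht ihs => exact .app (iht ρ) (ihs ρ)
  | lam _ ih => exact .lam (ih _)
  | beta _ _ iht ihs => rw [rename_inst]; exact .beta (iht _) (ihs ρ)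

theorem Par.upSubst {σ τ : ℕ → Tm C} (h : ∀ i, Par (σ i) (τ i)) (i : ℕ) :
    Par (upSubst σ i) (upSubst τ i) := by
  cases i with
  | zero => exact .var 0
  | succ i => exact (h i).rename _

theorem Par.subst {t t' : Tm C} (h : Par t t') {σ τ : ℕ → Tm C} (hσ : ∀ i, Par (σ i) (τ i)) :
    Par (subst σ t) (subst τ t') := by
  induction h generalizing σ τ with
  | var i => exact hσ i
  | const c => exact .const c
  | app _ _ iht ihs => exact .app (iht hσ) (ihs hσ)
  | lam _ ih => exact .lam (ih (Par.upSubst hσ))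
  | beta _ _ iht ihs => rw [subst_inst]; exact .beta (iht (Par.upSubst hσ)) (ihs hσ)

theorem Par.inst {t t' s s' : Tm C} (ht : Par t t') (hs : Par s s') :
    Par (t.inst s) (t'.inst s') := by
  refine ht.subst fun i => ?_
  cases i with
  | zero => exact hs
  | succ i => exact .var i

/-- The complete development of a term: all its redexes are contracted at once. -/
def develop : Tm C → Tm C
  | var i => var i
  | const c => const c
  | lam t => lam (develop t)
  | app (lam t) s => (develop t).inst (develop s)
  | app t s => app (develop t) (develop s)

theorem Par.develop {t u : Tm C} (h : Par t u) : Par u (develop t) := by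
  induction h with
  | var i => exact .var i
  | const c => exact .const c
  | lam _ ih => exact .lam ih
  | beta _ _ iht ihs => exact iht.inst ihs
  | @app t t' s s' ht _ iht ihs =>
    cases t with
    | lam t =>
      cases ht with
      | lam ht =>
        cases iht with
        | lam iht => exact .beta iht ihs
    | _ => exact .app iht ihs

theorem Red.confluent {t u v : Tm C} (hu : Red t u) (hv : Red t v) :
    ∃ w, Red u w ∧ Red v w := by
  have key : ∀ {a b : Tm C}, Red a b → Relation.ReflTransGen Par a b :=
    fun h => reflTransGen_map id (fun _ _ h => Par.of_step h) h
  have back : ∀ {a b : Tm C}, Relation.ReflTransGen Par a b → Red a b := fun h => by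
    induction h with
    | refl => exact .refl
    | tail _ h ih => exact ih.trans h.red
  obtain ⟨w, hw₁, hw₂⟩ := Relation.church_rosser
    (fun a b c hb hc => ⟨develop a, .single hb.develop, .single hc.develop⟩) (key hu) (key hv)
  exact ⟨w, back hw₁, back hw₂⟩

theorem Conv.join {t u : Tm C} (h : Conv t u) : ∃ w, Red t w ∧ Red u w := by
  induction h with
  | rel _ _ h => exact ⟨_, .single h, .refl⟩
  | refl _ => exact ⟨_, .refl, .refl⟩
  | symm _ _ _ ih =>
    obtain ⟨w, h₁, h₂⟩ := ih
    exact ⟨w, h₂, h₁⟩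
  | trans _ _ _ _ _ ih₁ ih₂ =>
    obtain ⟨w₁, h₁, h₂⟩ := ih₁
    obtain ⟨w₂, h₃, h₄⟩ := ih₂
    obtain ⟨w, h₅, h₆⟩ := h₂.confluent h₃
    exact ⟨w, h₁.trans h₅, h₄.trans h₆⟩

/-! ### Standardization -/

/-- Standard reduction: weak head reduction to a term whose immediate subterms are again reduced
in the standard way. -/
inductive Std : Tm C → Tm C → Prop
  | var {t : Tm C} {i : ℕ} : SpineRed t (var i) → Std t (var i)
  | const {t : Tm C} {c : C} : SpineRed t (const c) → Std t (const c)
  | app {t t₁ t₂ u₁ u₂ : Tm C} :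
      SpineRed t (app t₁ t₂) → Std t₁ u₁ → Std t₂ u₂ → Std t (app u₁ u₂)
  | lam {t t₁ u₁ : Tm C} : SpineRed t (lam t₁) → Std t₁ u₁ → Std t (lam u₁)

theorem Std.refl (t : Tm C) : Std t t := by
  induction t with
  | var i => exact .var .refl
  | const c => exact .const .refl
  | app _ _ iht ihs => exact .app .refl iht ihs
  | lam _ ih => exact .lam .refl ih

theorem Std.head {t t' u : Tm C} (h : SpineRed t t') (hu : Std t' u) : Std t u := by
  cases hu with
  | var h' => exact .var (h.trans h')
  | const h' => exact .const (h.trans h')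
  | app h' h₁ h₂ => exact .app (h.trans h') h₁ h₂
  | lam h' h₁ => exact .lam (h.trans h') h₁

theorem Std.rename {t u : Tm C} (h : Std t u) (ρ : ℕ → ℕ) : Std (rename ρ t) (rename ρ u) := by
  have key : ∀ {a b : Tm C} (ρ), SpineRed a b → SpineRed (Tm.rename ρ a) (Tm.rename ρ b) :=
    fun ρ h => reflTransGen_map (Tm.rename ρ) (fun _ _ h => h.rename ρ) h
  induction h generalizing ρ with
  | var h => exact .var (key ρ h)
  | const h => exact .const (key ρ h)
  | app h _ _ ih₁ ih₂ => exact .app (key ρ h) (ih₁ ρ) (ih₂ ρ)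
  | lam h _ ih => exact .lam (key ρ h) (ih _)

theorem Std.subst {t u : Tm C} (h : Std t u) {σ τ : ℕ → Tm C} (hσ : ∀ i, Std (σ i) (τ i)) :
    Std (subst σ t) (subst τ u) := by
  have key : ∀ {a b : Tm C} (σ), SpineRed a b → SpineRed (Tm.subst σ a) (Tm.subst σ b) :=
    fun σ h => reflTransGen_map (Tm.subst σ) (fun _ _ h => h.subst σ) h
  induction h generalizing σ τ with
  | var h => exact (hσ _).head (key σ h)
  | const h => exact .const (key σ h)
  | app h _ _ ih₁ ih₂ => exact .app (key σ h) (ih₁ hσ) (ih₂ hσ)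
  | lam h _ ih =>
    refine .lam (key σ h) (ih fun i => ?_)
    cases i with
    | zero => exact .refl _
    | succ i => exact (hσ i).rename _

theorem Std.tail {t u u' : Tm C} (h : Std t u) (hu : Step u u') : Std t u' := by
  induction hu generalizing t with
  | beta a b =>
    cases h with
    | app h h₁ h₂ =>
      cases h₁ with
      | lam h' h₁ =>
        refine Std.head ((h.trans (h'.app _)).tail (.beta _ _)) (h₁.subst fun i => ?_)
        cases i with
        | zero => exact h₂
        | succ i => exact .refl _
  | appLeft s _ ih =>
    cases h with
    | app h h₁ h₂ => exact .app h (ih h₁) h₂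
  | appRight s _ ih =>
    cases h with
    | app h h₁ h₂ => exact .app h h₁ (ih h₂)
  | lam _ ih =>
    cases h with
    | lam h h₁ => exact .lam h (ih h₁)

theorem Red.std {t u : Tm C} (h : Red t u) : Std t u := by
  induction h with
  | refl => exact .refl t
  | tail _ h ih => exact ih.tail h

theorem Std.red {t u : Tm C} (h : Std t u) : Red t u := by
  induction h with
  | var h => exact h.red
  | const h => exact h.red
  | app h _ _ ih₁ ih₂ => exact h.red.trans (ih₁.app ih₂)
  | lam h _ ih => exact h.red.trans ih.lam

/-! ### Terms headed by a constant -/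

/-- The terms `c t₁ … tₙ` with a constant `c` in head position. -/
inductive Rigid : Tm C → Prop
  | const (c : C) : Rigid (const c)
  | app {t : Tm C} (s : Tm C) : Rigid t → Rigid (app t s)

theorem Rigid.step_app {u a w : Tm C} (hu : Rigid u) (h : Step (Tm.app u a) w) :
    ∃ u' a', w = Tm.app u' a' ∧ Red u u' ∧ Red a a' := by
  cases h with
  | beta => cases hu
  | appLeft _ h => exact ⟨_, _, rfl, .single h, .refl⟩
  | appRight _ h => exact ⟨_, _, rfl, .refl, .single h⟩

theorem Rigid.step {u u' : Tm C} (hu : Rigid u) (h : Step u u') : Rigid u' := by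
  induction hu generalizing u' with
  | const c => cases h
  | @app t s hu ih =>
    cases h with
    | beta => cases hu
    | appLeft _ h => exact .app _ (ih h)
    | appRight _ h => exact .app _ hu

theorem Rigid.red {u u' : Tm C} (hu : Rigid u) (h : Red u u') : Rigid u' := by
  induction h with
  | refl => exact hu
  | tail _ h ih => exact ih.step h

theorem Rigid.red_app {u a w : Tm C} (hu : Rigid u) (h : Red (Tm.app u a) w) :
    ∃ u' a', w = Tm.app u' a' ∧ Red u u' ∧ Red a a' := by
  induction h with
  | refl => exact ⟨u, a, rfl, .refl, .refl⟩
  | tail _ h ih =>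
    obtain ⟨u₁, a₁, rfl, h₁, h₂⟩ := ih
    obtain ⟨u₂, a₂, rfl, h₃, h₄⟩ := (hu.red h₁).step_app h
    exact ⟨u₂, a₂, rfl, h₁.trans h₃, h₂.trans h₄⟩

/-- Weak head reduction of a term equivalent to `u a`, with a constant in head position of `u`,
reaches an application whose two parts are equivalent to `u` and `a`. -/
theorem Rigid.conv_app {u a t : Tm C} (hu : Rigid u) (h : Conv t (Tm.app u a)) :
    ∃ t₁ t₂, SpineRed t (Tm.app t₁ t₂) ∧ Conv t₁ u ∧ Conv t₂ a := by
  obtain ⟨w, h₁, h₂⟩ := h.join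
  obtain ⟨u', a', rfl, h₃, h₄⟩ := hu.red_app h₂
  cases h₁.std with
  | app h h₅ h₆ =>
    exact ⟨_, _, h, h₅.red.conv.trans _ _ _ (h₃.conv.symm _ _), h₆.red.conv.trans _ _ _ (h₄.conv.symm _ _)⟩

theorem Conv.spineRed_const {t : Tm C} {c : C} (h : Conv t (const c)) : SpineRed t (const c) := by
  obtain ⟨w, h₁, h₂⟩ := h.join
  have hw : w = const c := by
    clear h₁
    induction h₂ with
    | refl => rfl
    | tail _ h ih => subst ih; cases h
  subst hw
  cases h₁.std with
  | const h => exact h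

end Tm

end StorageOp

namespace StorageOp

/-! ### Simultaneous substitution in formulas -/

section FirstOrderTerms

variable {L : FirstOrder.Language.{u, v}} {α β γ : Type*}

theorem term_subst_subst (t : L.Term α) (s : α → L.Term β) (r : β → L.Term γ) :
    (t.subst s).subst r = t.subst fun i => (s i).subst r := by
  induction t with
  | var i => rfl
  | func f ts ih =>
    simp only [FirstOrder.Language.Term.subst]
    congr 1
    funext i
    exact ih i

theorem term_subst_var (t : L.Term α) : t.subst FirstOrder.Language.Term.var = t := by
  induction t with
  | var i => rfl
  | func f ts ih =>
    simp only [FirstOrder.Language.Term.subst]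
    congr 1
    funext i
    exact ih i

theorem term_relabel_eq_subst (t : L.Term α) (g : α → β) :
    t.relabel g = t.subst fun i => FirstOrder.Language.Term.var (g i) := by
  induction t with
  | var i => rfl
  | func f ts ih =>
    simp only [FirstOrder.Language.Term.subst, FirstOrder.Language.Term.relabel]
    congr 1
    funext i
    exact ih i

end FirstOrderTerms

namespace Formula

variable {L : FirstOrder.Language.{u, v}} {K K' K'' : Type}

/-- The variable `i + m` in place of the first order variable `i`. -/
def shiftVar (L : FirstOrder.Language.{u, v}) (m i : ℕ) : L.Term ℕ :=
  FirstOrder.Language.Term.var (i + m)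

/-- A first order substitution, extended under the `n` parameters of a formula. -/
def liftArgs (n : ℕ) (s : ℕ → L.Term ℕ) (j : ℕ) : L.Term ℕ :=
  if j < n then FirstOrder.Language.Term.var j else (s (j - n)).subst (shiftVar L n)

theorem liftArgs_subst (n : ℕ) (s r : ℕ → L.Term ℕ) (j : ℕ) :
    (liftArgs n s j).subst (liftArgs n r) = liftArgs n (fun i => (s i).subst r) j := by
  unfold liftArgs
  split_ifs with h
  · simp [FirstOrder.Language.Term.subst, h]
  · simp only [term_subst_subst]
    congr 1
    funext i
    simp [shiftVar, FirstOrder.Language.Term.subst]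

theorem liftArgs_var (n : ℕ) :
    liftArgs n (FirstOrder.Language.Term.var : ℕ → L.Term ℕ) = FirstOrder.Language.Term.var := by
  funext j
  unfold liftArgs
  split_ifs with h
  · rfl
  · simp [FirstOrder.Language.Term.subst, shiftVar, Nat.sub_add_cancel (not_lt.mp h)]

theorem liftArgs_args {n : ℕ} (ts : Fin n → L.Term ℕ) (s : ℕ → L.Term ℕ) (j : ℕ) :
    (liftArgs n s j).subst (args fun i => (ts i).subst s) = (args ts j).subst s := by
  unfold liftArgs
  by_cases h : j < n
  · simp [h, args, FirstOrder.Language.Term.subst]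
  · simp only [h, if_false, term_subst_subst, args, dif_neg, not_false_iff,
      FirstOrder.Language.Term.subst]
    conv_rhs => rw [← term_subst_var (s (j - n))]
    congr 1
    funext i
    simp [shiftVar, FirstOrder.Language.Term.subst, args]

theorem upSubst₁_var :
    upSubst₁ (FirstOrder.Language.Term.var : ℕ → L.Term ℕ) = FirstOrder.Language.Term.var := by
  funext i; cases i <;> rfl

theorem upSubst₁_subst (s r : ℕ → L.Term ℕ) (i : ℕ) :
    (upSubst₁ s i).subst (upSubst₁ r) = upSubst₁ (fun i => (s i).subst r) i := by
  cases i with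
  | zero => rfl
  | succ i =>
    simp only [upSubst₁, term_relabel_eq_subst, term_subst_subst]
    congr 1
    funext j
    simp only [FirstOrder.Language.Term.subst, upSubst₁, term_relabel_eq_subst]

variable [DecidableEq K] [DecidableEq K'] [DecidableEq K'']

/-- Simultaneous substitution of terms for the first order variables and renaming of the second
order variables. -/
def substRen : (ℕ → L.Term ℕ) → (K → ℕ → ℕ → ℕ) → Formula L K → Formula L K
  | _, _, bot => bot
  | s, _, rel n R ts => rel n R (fun j => (ts j).subst s)
  | s, ρ, pvar k n i ts => pvar k n (ρ k n i) (fun j => (ts j).subst s)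
  | s, ρ, imp A B => imp (substRen s ρ A) (substRen s ρ B)
  | s, ρ, all₁ A => all₁ (substRen (upSubst₁ s) ρ A)
  | s, ρ, all₂ k n A => all₂ k n (substRen s (upRen₂ k n ρ) A)

/-- The identical renaming of second order variables. -/
abbrev idRen : K → ℕ → ℕ → ℕ := fun _ _ i => i

/-- The renaming of second order variables which makes room for a new variable of index `0`. -/
def shiftRen (k : K) (n : ℕ) (k' : K) (n' i : ℕ) : ℕ := if k' = k ∧ n' = n then i + 1 else i

theorem upRen₂_idRen (k : K) (n : ℕ) : upRen₂ k n (idRen : K → ℕ → ℕ → ℕ) = idRen := by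
  funext k' n' i
  unfold upRen₂
  split_ifs
  · cases i <;> rfl
  · rfl

theorem upRen₂_upRen₂ (k : K) (n : ℕ) (ρ ρ' : K → ℕ → ℕ → ℕ) (k' : K) (n' i : ℕ) :
    upRen₂ k n ρ k' n' (upRen₂ k n ρ' k' n' i)
      = upRen₂ k n (fun k n i => ρ k n (ρ' k n i)) k' n' i := by
  unfold upRen₂
  split_ifs
  · cases i <;> rfl
  · rfl

theorem upRen₂_shiftRen (k : K) (n : ℕ) (ρ : K → ℕ → ℕ → ℕ) (k' : K) (n' i : ℕ) :
    upRen₂ k n ρ k' n' (shiftRen k n k' n' i) = shiftRen k n k' n' (ρ k' n' i) := by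
  unfold upRen₂ shiftRen
  split_ifs <;> rfl

theorem subst₁_eq_substRen (s : ℕ → L.Term ℕ) (A : Formula L K) :
    subst₁ s A = substRen s idRen A := by
  induction A generalizing s with
  | bot => rfl
  | rel => rfl
  | pvar => rfl
  | imp A B ihA ihB => simp only [subst₁, substRen, ihA, ihB]
  | all₁ A ih => simp only [subst₁, substRen, ih]
  | all₂ k n A ih => simp only [subst₁, substRen, ih, upRen₂_idRen]

theorem rename₂_eq_substRen (ρ : K → ℕ → ℕ → ℕ) (A : Formula L K) :
    rename₂ ρ A = substRen FirstOrder.Language.Term.var ρ A := by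
  induction A generalizing ρ with
  | bot => rfl
  | rel => simp only [rename₂, substRen, term_subst_var]
  | pvar => simp only [rename₂, substRen, term_subst_var]
  | imp A B ihA ihB => simp only [rename₂, substRen, ihA, ihB]
  | all₁ A ih => simp only [rename₂, substRen, ih, upSubst₁_var]
  | all₂ k n A ih => simp only [rename₂, substRen, ih]

theorem shift₂_eq_substRen (k : K) (n : ℕ) (A : Formula L K) :
    shift₂ k n A = substRen FirstOrder.Language.Term.var (shiftRen k n) A :=
  rename₂_eq_substRen _ A

theorem substRen_var (A : Formula L K) :
    substRen FirstOrder.Language.Term.var idRen A = A := by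
  induction A with
  | bot => rfl
  | rel => simp only [substRen, term_subst_var]
  | pvar => simp only [substRen, term_subst_var]
  | imp A B ihA ihB => simp only [substRen, ihA, ihB]
  | all₁ A ih => simp only [substRen, upSubst₁_var, ih]
  | all₂ k n A ih => simp only [substRen, upRen₂_idRen, ih]

theorem substRen_substRen (s s' : ℕ → L.Term ℕ) (ρ ρ' : K → ℕ → ℕ → ℕ) (A : Formula L K) :
    substRen s ρ (substRen s' ρ' A)
      = substRen (fun i => (s' i).subst s) (fun k n i => ρ k n (ρ' k n i)) A := by
  induction A generalizing s s' ρ ρ' with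
  | bot => rfl
  | rel => simp only [substRen, term_subst_subst]
  | pvar => simp only [substRen, term_subst_subst]
  | imp A B ihA ihB => simp only [substRen, ihA, ihB]
  | all₁ A ih => simp only [substRen, ih, upSubst₁_subst]
  | all₂ k n A ih => simp only [substRen, ih, upRen₂_upRen₂]

theorem substRen_generic (s : ℕ → L.Term ℕ) (ρ : K → ℕ → ℕ → ℕ) (k : K) (n i : ℕ) :
    substRen (liftArgs n s) ρ (generic k n i) = generic k n (ρ k n i) := by
  simp only [substRen, generic]
  congr 1
  funext j
  simp [FirstOrder.Language.Term.subst, liftArgs]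

theorem substRen_args_generic {n : ℕ} (ts : Fin n → L.Term ℕ) (k : K) (i : ℕ) :
    substRen (args ts) idRen (generic k n i) = pvar k n i ts := by
  simp only [substRen, generic]
  congr 1
  funext j
  simp [FirstOrder.Language.Term.subst, args]

/-- A family of formulas, to be substituted for second order variables, moved under `m` new first
order variables. -/
def shiftFam (m : ℕ) (S : K → ℕ → ℕ → Formula L K') (k : K) (n i : ℕ) : Formula L K' :=
  substRen (liftArgs n (shiftVar L m)) idRen (S k n i)

/-- A family of formulas, to be substituted for second order variables, extended under a second
order binder. The sorts are changed by `φ`. -/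
def upFam (φ : K → K') (k : K) (n : ℕ) (S : K → ℕ → ℕ → Formula L K') (k' : K) (n' : ℕ) (i : ℕ) :
    Formula L K' :=
  if k' = k ∧ n' = n then
    (match i with | 0 => generic (φ k') n' 0 | j + 1 => shift₂ (φ k) n (S k' n' j))
  else shift₂ (φ k) n (S k' n' i)

/-- The most general substitution: terms for the first order variables and formulas, which may
have other sorts of variables, for the second order variables. The formulas of the family are
relative to the first order variables of the result. -/
def act : (ℕ → L.Term ℕ) → (K → K') → (K → ℕ → ℕ → Formula L K') → Formula L K → Formula L K'
  | _, _, _, bot => bot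
  | s, _, _, rel n R ts => rel n R (fun j => (ts j).subst s)
  | s, _, S, pvar k n i ts => substRen (args fun j => (ts j).subst s) idRen (S k n i)
  | s, φ, S, imp A B => imp (act s φ S A) (act s φ S B)
  | s, φ, S, all₁ A => all₁ (act (upSubst₁ s) φ (shiftFam 1 S) A)
  | s, φ, S, all₂ k n A => all₂ (φ k) n (act s φ (upFam φ k n S) A)

theorem subst₂_eq_act (S : K → ℕ → ℕ → Formula L K) (A : Formula L K) :
    subst₂ S A = act FirstOrder.Language.Term.var id S A := by
  induction A generalizing S with
  | bot => rfl
  | rel => simp only [subst₂, act, term_subst_var]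
  | pvar => simp only [subst₂, act, term_subst_var, subst₁_eq_substRen]
  | imp A B ihA ihB => simp only [subst₂, act, ihA, ihB]
  | all₁ A ih =>
    simp only [subst₂, act, ih, upSubst₁_var, subst₁_eq_substRen]
    congr 2
    funext k n i
    unfold shiftFam
    congr 1
    funext j
    unfold liftArgs
    split_ifs with h
    · rfl
    · simp only [FirstOrder.Language.Term.subst, shiftVar]
      congr 1; omega
  | all₂ k n A ih => simp only [subst₂, act, ih]; rfl

theorem act_substRen (s s' : ℕ → L.Term ℕ) (φ : K → K') (S : K → ℕ → ℕ → Formula L K')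
    (ρ : K → ℕ → ℕ → ℕ) (A : Formula L K) :
    act s φ S (substRen s' ρ A)
      = act (fun i => (s' i).subst s) φ (fun k n i => S k n (ρ k n i)) A := by
  induction A generalizing s s' S ρ with
  | bot => rfl
  | rel => simp only [substRen, act, term_subst_subst]
  | pvar => simp only [substRen, act, term_subst_subst]
  | imp A B ihA ihB => simp only [substRen, act, ihA, ihB]
  | all₁ A ih => simp only [substRen, act, ih, upSubst₁_subst]; rfl
  | all₂ k n A ih =>
    simp only [substRen, act, ih]
    congr 2
    funext k' n' i
    unfold upFam upRen₂
    split_ifs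
    · cases i <;> rfl
    · rfl

omit [DecidableEq K] in
theorem substRen_shiftFam (s : ℕ → L.Term ℕ) (ρ : K' → ℕ → ℕ → ℕ)
    (S : K → ℕ → ℕ → Formula L K') (k : K) (n i : ℕ) :
    substRen (liftArgs n (upSubst₁ s)) ρ (shiftFam 1 S k n i)
      = shiftFam 1 (fun k n i => substRen (liftArgs n s) ρ (S k n i)) k n i := by
  unfold shiftFam
  simp only [substRen_substRen, liftArgs_subst]
  congr 2
  funext j
  simp only [shiftVar, FirstOrder.Language.Term.subst, upSubst₁, term_relabel_eq_subst]
  rfl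

theorem substRen_shift₂ (s : ℕ → L.Term ℕ) (ρ : K → ℕ → ℕ → ℕ) (k : K) (n : ℕ)
    (A : Formula L K) :
    substRen s (upRen₂ k n ρ) (shift₂ k n A) = shift₂ k n (substRen s ρ A) := by
  simp only [shift₂_eq_substRen, substRen_substRen, upRen₂_shiftRen, term_subst_var]
  rfl

theorem substRen_act (s s' : ℕ → L.Term ℕ) (φ : K → K') (S : K → ℕ → ℕ → Formula L K')
    (ρ : K' → ℕ → ℕ → ℕ) (A : Formula L K) :
    substRen s ρ (act s' φ S A)
      = act (fun i => (s' i).subst s) φ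
          (fun k n i => substRen (liftArgs n s) ρ (S k n i)) A := by
  induction A generalizing s s' S ρ with
  | bot => rfl
  | rel => simp only [substRen, act, term_subst_subst]
  | pvar k n i ts =>
    simp only [act, substRen_substRen, ← term_subst_subst]
    congr 1
    funext j
    exact (liftArgs_args _ s j).symm
  | imp A B ihA ihB => simp only [substRen, act, ihA, ihB]
  | all₁ A ih =>
    simp only [substRen, act, ih, upSubst₁_subst]
    congr 2
    funext k n i
    exact substRen_shiftFam s ρ S k n i
  | all₂ k n A ih =>
    simp only [substRen, act, ih]
    congr 2
    funext k' n' i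
    unfold upFam
    split_ifs with h
    · obtain ⟨rfl, rfl⟩ := h
      cases i with
      | zero => simp [substRen_generic, upRen₂]
      | succ i => exact substRen_shift₂ _ ρ _ _ _
    · exact substRen_shift₂ _ ρ _ _ _

omit [DecidableEq K] in
theorem shiftFam_shift₂ (m : ℕ) (k : K') (n : ℕ) (S : K → ℕ → ℕ → Formula L K') (k' : K)
    (n' i : ℕ) :
    substRen (liftArgs n' (shiftVar L m)) idRen (shift₂ k n (S k' n' i))
      = shift₂ k n (shiftFam m S k' n' i) := by
  rw [← upRen₂_idRen k n, substRen_shift₂]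
  rfl

omit [DecidableEq K] in
/-- Second order instances computed under `m` parameters do not depend on these parameters. -/
theorem substRen_liftArgs_shiftFam {m : ℕ} (r : ℕ → L.Term ℕ)
    (hr : ∀ j, r (j + m) = FirstOrder.Language.Term.var j) (S : K → ℕ → ℕ → Formula L K') (k : K)
    (n i : ℕ) :
    substRen (liftArgs n r) idRen (shiftFam m S k n i) = S k n i := by
  unfold shiftFam
  simp only [substRen_substRen, liftArgs_subst]
  have : (fun i => (shiftVar L m i).subst r) = FirstOrder.Language.Term.var := by
    funext j
    exact hr j
  simp only [this, liftArgs_var, substRen_var]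

theorem args_add {n : ℕ} (ts : Fin n → L.Term ℕ) (j : ℕ) :
    args ts (j + n) = FirstOrder.Language.Term.var j := by
  simp [args]

theorem act_act (s s' : ℕ → L.Term ℕ) (φ : K' → K'') (φ' : K → K')
    (S : K' → ℕ → ℕ → Formula L K'') (S' : K → ℕ → ℕ → Formula L K') (A : Formula L K) :
    act s φ S (act s' φ' S' A)
      = act (fun i => (s' i).subst s) (φ ∘ φ')
          (fun k n i => act (liftArgs n s) φ (shiftFam n S) (S' k n i)) A := by
  induction A generalizing s s' S S' with
  | bot => rfl
  | rel => simp only [act, term_subst_subst]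
  | pvar k n i ts =>
    simp only [act, act_substRen, substRen_act, ← term_subst_subst, liftArgs_args,
      substRen_liftArgs_shiftFam _ (args_add _)]
  | imp A B ihA ihB => simp only [act, ihA, ihB]
  | all₁ A ih =>
    simp only [act, ih, upSubst₁_subst]
    congr 2
    funext k n i
    simp only [shiftFam, act_substRen, substRen_act, liftArgs_subst, substRen_substRen]
    congr 1
    · funext j
      simp only [shiftVar, FirstOrder.Language.Term.subst, upSubst₁, term_relabel_eq_subst]
      rfl
    · funext k' n' i'
      congr 2
      funext i
      simp [shiftVar, FirstOrder.Language.Term.subst, liftArgs]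
  | all₂ k n A ih =>
    simp only [act, ih]
    congr 2
    funext k' n' i
    have key : ∀ G : Formula L K',
        act (liftArgs n' s) φ (shiftFam n' (upFam φ (φ' k) n S)) (shift₂ (φ' k) n G)
          = shift₂ (φ (φ' k)) n (act (liftArgs n' s) φ (shiftFam n' S) G) := by
      intro G
      rw [shift₂_eq_substRen, act_substRen, shift₂_eq_substRen, substRen_act]
      simp only [term_subst_var, liftArgs_var, ← shift₂_eq_substRen]
      congr 1
      funext κ m i
      rw [← shiftFam_shift₂]
      unfold shiftFam
      congr 1
      unfold upFam shiftRen
      split_ifs <;> rfl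
    unfold upFam
    split_ifs with h
    · obtain ⟨rfl, rfl⟩ := h
      cases i with
      | zero =>
        have h := substRen_generic (shiftVar L n') (idRen : K'' → ℕ → ℕ → ℕ) (φ (φ' k')) n' 0
        simp only [generic, act, shiftFam, true_and, if_true]
        refine ((congrArg _ h).trans (substRen_args_generic _ _ _)).trans ?_
        simp only [Function.comp]
        congr 1
        funext j
        simp [FirstOrder.Language.Term.subst, liftArgs]
      | succ i => exact key _
    · exact key _

theorem act_generic (s : ℕ → L.Term ℕ) {φ : K → K'} (hφ : Function.Injective φ)
    (A : Formula L K) :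
    act s φ (fun k n i => generic (φ k) n i) A = substRen s idRen (mapSort φ A) := by
  induction A generalizing s with
  | bot => rfl
  | rel => rfl
  | pvar k n i ts => exact substRen_args_generic _ _ _
  | imp A B ihA ihB => simp only [act, mapSort, substRen, ihA, ihB]
  | all₁ A ih =>
    simp only [act, mapSort, substRen, ← ih]
    congr 2
    funext k n i
    exact substRen_generic _ _ _ _ _
  | all₂ k n A ih =>
    simp only [act, mapSort, substRen, upRen₂_idRen, ← ih]
    congr 2
    funext k' n' i
    have key : shift₂ (φ k) n (generic (φ k') n' i : Formula L K')
        = generic (φ k') n' (shiftRen (φ k) n (φ k') n' i) := by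
      rw [shift₂_eq_substRen, ← liftArgs_var n', substRen_generic]
    unfold upFam
    split_ifs with h
    · obtain ⟨rfl, rfl⟩ := h
      cases i with
      | zero => rfl
      | succ i =>
        refine (shift₂_eq_substRen _ _ _).trans ?_
        rw [← liftArgs_var n', substRen_generic]
        simp [shiftRen]
    · rw [key]
      have : ¬ (φ k' = φ k ∧ n' = n) := fun h' => h ⟨hφ h'.1, h'.2⟩
      simp [shiftRen, this]

omit [DecidableEq K] in
theorem mapSort_id (A : Formula L K) : mapSort id A = A := by
  induction A with
  | bot => rfl
  | rel => rfl
  | pvar => rfl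
  | imp A B ihA ihB => simp only [mapSort, ihA, ihB]
  | all₁ A ih => simp only [mapSort, ih]
  | all₂ k n A ih => simp only [mapSort, ih]; rfl

theorem mapSort_eq_act {φ : K → K'} (hφ : Function.Injective φ) (A : Formula L K) :
    mapSort φ A = act FirstOrder.Language.Term.var φ (fun k n i => generic (φ k) n i) A := by
  rw [act_generic _ hφ, substRen_var]

theorem substRen_eq_act (s : ℕ → L.Term ℕ) (ρ : K → ℕ → ℕ → ℕ) (A : Formula L K) :
    substRen s ρ A = act s id (fun k n i => generic k n (ρ k n i)) A := by
  have h := act_substRen s FirstOrder.Language.Term.var id (fun k n i => generic k n i) ρ A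
  have h' := act_generic s Function.injective_id
    (substRen (FirstOrder.Language.Term.var : ℕ → L.Term ℕ) ρ A)
  simp only [id] at h'
  rw [mapSort_id, substRen_substRen] at h'
  exact (h'.symm.trans h)

/-- A family of formulas with a new first formula of sort `k` and arity `n`. -/
def consFam {α : Type*} (k : K) (n : ℕ) (G : α) (S : K → ℕ → ℕ → α) (k' : K) (n' i : ℕ) : α :=
  if k' = k ∧ n' = n then (match i with | 0 => G | j + 1 => S k' n' j) else S k' n' i

theorem consFam_shiftRen {α : Type*} (k : K) (n : ℕ) (G : α) (S : K → ℕ → ℕ → α) (k' : K)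
    (n' i : ℕ) : consFam k n G S k' n' (shiftRen k n k' n' i) = S k' n' i := by
  unfold consFam shiftRen
  split_ifs <;> rfl

theorem inst₁_eq (A : Formula L K) (a : L.Term ℕ) :
    A.inst₁ a = substRen (scons a FirstOrder.Language.Term.var) idRen A := by
  rw [← subst₁_eq_substRen]
  unfold inst₁
  congr 1

theorem inst₂_eq (k : K) (n : ℕ) (A G : Formula L K) :
    A.inst₂ k n G
      = act FirstOrder.Language.Term.var id (consFam k n G (fun k n i => generic k n i)) A := by
  rw [← subst₂_eq_act]
  rfl

theorem shift₁_eq (A : Formula L K) : A.shift₁ = substRen (shiftVar L 1) idRen A :=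
  subst₁_eq_substRen _ A

end Formula

end StorageOp

namespace StorageOp

namespace Formula

variable {L : FirstOrder.Language.{u, v}} {K K' : Type} [DecidableEq K] [DecidableEq K']

theorem act_shift₁ (s : ℕ → L.Term ℕ) (φ : K → K') (S : K → ℕ → ℕ → Formula L K')
    (A : Formula L K) :
    act (upSubst₁ s) φ (shiftFam 1 S) A.shift₁ = (act s φ S A).shift₁ := by
  rw [shift₁_eq, shift₁_eq, act_substRen, substRen_act]
  congr 1
  funext i
  simp only [shiftVar, FirstOrder.Language.Term.subst, upSubst₁, term_relabel_eq_subst]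
  rfl

/-- Instantiating the bound first order variable after the substitution `act`. -/
theorem inst₁_act (a : L.Term ℕ) (s : ℕ → L.Term ℕ) (φ : K → K')
    (S : K → ℕ → ℕ → Formula L K') (A : Formula L K) :
    (act s φ (shiftFam 1 S) A).inst₁ a
      = act (fun i => (s i).subst (scons a FirstOrder.Language.Term.var)) φ S A := by
  rw [inst₁_eq, substRen_act]
  congr 1
  funext k n i
  exact substRen_liftArgs_shiftFam _ (fun _ => rfl) S k n i

theorem upSubst₁_scons (a : L.Term ℕ) (s r : ℕ → L.Term ℕ) (i : ℕ) :
    (upSubst₁ s i).subst (scons a r) = scons a (fun i => (s i).subst r) i := by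
  cases i with
  | zero => rfl
  | succ i =>
    simp only [upSubst₁, term_relabel_eq_subst, term_subst_subst, FirstOrder.Language.Term.subst,
      scons]

theorem scons_subst (a : L.Term ℕ) (s r : ℕ → L.Term ℕ) (i : ℕ) :
    (scons a s i).subst r = scons (a.subst r) (fun i => (s i).subst r) i := by
  cases i <;> rfl

theorem act_inst₁ (s : ℕ → L.Term ℕ) (φ : K → K') (S : K → ℕ → ℕ → Formula L K')
    (A : Formula L K) (a : L.Term ℕ) :
    act s φ S (A.inst₁ a) = (act (upSubst₁ s) φ (shiftFam 1 S) A).inst₁ (a.subst s) := by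
  rw [inst₁_act, inst₁_eq, act_substRen]
  congr 1
  funext i
  rw [upSubst₁_scons, scons_subst]
  simp only [FirstOrder.Language.Term.subst, term_subst_var]

theorem act_shift₂ (s : ℕ → L.Term ℕ) (φ : K → K') (S : K → ℕ → ℕ → Formula L K') (k : K) (n : ℕ)
    (A : Formula L K) :
    act s φ (upFam φ k n S) (A.shift₂ k n) = (act s φ S A).shift₂ (φ k) n := by
  rw [shift₂_eq_substRen, shift₂_eq_substRen, act_substRen, substRen_act]
  simp only [term_subst_var, liftArgs_var, ← shift₂_eq_substRen]
  congr 1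
  funext k' n' i
  unfold upFam shiftRen
  split_ifs <;> rfl

/-- Substituting the parameters of a formula for themselves. -/
theorem substRen_args_self (n : ℕ) (s : ℕ → L.Term ℕ) (G : Formula L K) :
    substRen (args fun j : Fin n => (FirstOrder.Language.Term.var (j : ℕ)).subst (liftArgs n s))
      idRen (substRen (liftArgs n (shiftVar L n)) idRen G) = G := by
  rw [substRen_substRen]
  conv_rhs => rw [← substRen_var G]
  congr 1
  funext j
  unfold liftArgs
  split_ifs with h
  · simp [FirstOrder.Language.Term.subst, args, h]
  · simp [FirstOrder.Language.Term.subst, args, shiftVar, Nat.sub_add_cancel (not_lt.mp h)]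

theorem act_generic_shiftFam (n : ℕ) (s : ℕ → L.Term ℕ) (φ : K → K')
    (S : K → ℕ → ℕ → Formula L K') (k : K) (i : ℕ) :
    act (liftArgs n s) φ (shiftFam n S) (generic k n i) = S k n i :=
  substRen_args_self n s (S k n i)

theorem act_var_generic (A : Formula L K) :
    act FirstOrder.Language.Term.var id (fun k n i => generic k n i) A = A := by
  have h := act_generic (FirstOrder.Language.Term.var : ℕ → L.Term ℕ) Function.injective_id A
  rwa [mapSort_id, substRen_var] at h

theorem shiftFam_generic (m : ℕ) :
    shiftFam m (fun k n i => (generic k n i : Formula L K)) = fun k n i => generic k n i := by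
  funext k n i
  exact substRen_generic _ _ k n i

theorem act_inst₂ (s : ℕ → L.Term ℕ) (φ : K → K') (S : K → ℕ → ℕ → Formula L K') (k : K) (n : ℕ)
    (A G : Formula L K) :
    act s φ S (A.inst₂ k n G)
      = (act s φ (upFam φ k n S) A).inst₂ (φ k) n (act (liftArgs n s) φ (shiftFam n S) G) := by
  rw [inst₂_eq, inst₂_eq, act_act, act_act]
  simp only [term_subst_var, liftArgs_var, FirstOrder.Language.Term.subst, Function.comp_id,
    Function.id_comp]
  congr 1
  funext k' n' i
  have key : ∀ H : Formula L K', act FirstOrder.Language.Term.var id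
      (shiftFam n' (consFam (φ k) n (act (liftArgs n s) φ (shiftFam n S) G)
        fun k n i => generic k n i)) (shift₂ (φ k) n H) = H := by
    intro H
    rw [shift₂_eq_substRen, act_substRen]
    simp only [term_subst_var, shiftFam, consFam_shiftRen]
    have := shiftFam_generic (L := L) (K := K') n'
    unfold shiftFam at this
    rw [this, act_var_generic]
  by_cases h : k' = k ∧ n' = n
  · obtain ⟨rfl, rfl⟩ := h
    cases i with
    | zero =>
      have := act_generic_shiftFam n' FirstOrder.Language.Term.var id
        (consFam (φ k') n' (act (liftArgs n' s) φ (shiftFam n' S) G) fun k n i => generic k n i)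
        (φ k') 0
      rw [liftArgs_var] at this
      simpa [consFam, upFam] using this.symm
    | succ i =>
      simp only [consFam, upFam, and_self, if_true, act_generic_shiftFam]
      exact (key _).symm
  · simp only [consFam, upFam, h, if_false, act_generic_shiftFam]
    exact (key _).symm

end Formula

open Formula

variable {L : FirstOrder.Language.{u, v}} {K K' : Type} [DecidableEq K] [DecidableEq K']
  {Eqs : Set (L.Term ℕ × L.Term ℕ)}

/-! ### Structural properties of typing -/

theorem Approx.subst {a b : L.Term ℕ} (h : Approx Eqs a b) (s : ℕ → L.Term ℕ) :
    Approx Eqs (a.subst s) (b.subst s) := by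
  refine eqvGen_map (fun t : L.Term ℕ => t.subst s) ?_ h
  rintro a b ⟨p, hp, r, rfl, rfl⟩
  exact ⟨p, hp, fun i => (r i).subst s, term_subst_subst _ _ _, term_subst_subst _ _ _⟩

/-- Renaming of the term variables of a typing. Only the variables which occur matter, so that
this contains weakening and strengthening of the context. -/
theorem Typing.rename {adm : K → Formula L K → Prop} {Γ : List (Formula L K)} {t : Lam}
    {A : Formula L K} (h : Typing Eqs adm Γ t A) {Γ' : List (Formula L K)} {ρ : ℕ → ℕ}
    (hρ : ∀ i B, t.HasFree i → Γ[i]? = some B → Γ'[ρ i]? = some B) :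
    Typing Eqs adm Γ' (Lam.rename ρ t) A := by
  induction h generalizing Γ' ρ with
  | var h => exact .var (hρ _ _ rfl h)
  | lam _ ih =>
    refine .lam (ih fun i B hi hB => ?_)
    cases i with
    | zero => exact hB
    | succ i => exact hρ i B hi hB
  | app _ _ ih₁ ih₂ =>
    exact .app (ih₁ fun i B hi => hρ i B (Or.inl hi)) (ih₂ fun i B hi => hρ i B (Or.inr hi))
  | all₁Intro _ ih =>
    refine .all₁Intro (ih fun i B hi hB => ?_)
    rw [List.getElem?_map, Option.map_eq_some_iff] at hB ⊢
    obtain ⟨B', hB', rfl⟩ := hB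
    exact ⟨B', hρ i B' hi hB', rfl⟩
  | all₁Elim a _ ih => exact .all₁Elim a (ih hρ)
  | all₂Intro _ ih =>
    refine .all₂Intro (ih fun i B hi hB => ?_)
    rw [List.getElem?_map, Option.map_eq_some_iff] at hB ⊢
    obtain ⟨B', hB', rfl⟩ := hB
    exact ⟨B', hρ i B' hi hB', rfl⟩
  | all₂Elim G hG _ ih => exact .all₂Elim G hG (ih hρ)
  | eq A hab _ ih => exact .eq A hab (ih hρ)

theorem Typing.lt_length {adm : K → Formula L K → Prop} {Γ : List (Formula L K)} {t : Lam}
    {A : Formula L K} (h : Typing Eqs adm Γ t A) {i : ℕ} (hi : t.HasFree i) : i < Γ.length := by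
  induction h generalizing i with
  | var h =>
    obtain ⟨h, _⟩ := List.getElem?_eq_some_iff.mp h
    exact hi ▸ h
  | lam _ ih => simpa using ih hi
  | app _ _ ih₁ ih₂ => exact hi.elim ih₁ ih₂
  | all₁Intro _ ih => simpa using ih hi
  | all₁Elim a _ ih => exact ih hi
  | all₂Intro _ ih => simpa using ih hi
  | all₂Elim G hG _ ih => exact ih hi
  | eq A hab _ ih => exact ih hi

/-- A term without free variables keeps its types in every context. -/
theorem Typing.of_closed {adm : K → Formula L K → Prop} {Γ : List (Formula L K)} {t : Lam}
    {A : Formula L K} (h : Typing Eqs adm Γ t A) (ht : t.Closed) (Γ' : List (Formula L K)) :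
    Typing Eqs adm Γ' t A := by
  have := h.rename (Γ' := Γ') (ρ := fun i => i) fun i _ hi => (ht i hi).elim
  have hid : Lam.rename (fun i => i) t = t := by
    have := Lam.subst_rename Lam.var (fun i => i) t
    rwa [Lam.subst_var, Lam.subst_var] at this
  rwa [hid] at this

/-- The substitution of formulas with admissible values `S` for the second order variables carries
admissible instances to admissible instances. -/
structure AdmMap (adm : K → Formula L K → Prop) (adm' : K' → Formula L K' → Prop)
    (φ : K → K') : Prop where
  act : ∀ (s : ℕ → L.Term ℕ) (S : K → ℕ → ℕ → Formula L K') (k : K) (G : Formula L K),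
    (∀ k n i, adm' (φ k) (S k n i)) → adm k G → adm' (φ k) (Formula.act s φ S G)
  generic : ∀ k n i, adm' (φ k) (Formula.generic (φ k) n i)
  substRen : ∀ (s : ℕ → L.Term ℕ) (ρ : K' → ℕ → ℕ → ℕ) (k : K') (G : Formula L K'),
    adm' k G → adm' k (Formula.substRen s ρ G)

theorem AdmMap.upFam {adm : K → Formula L K → Prop} {adm' : K' → Formula L K' → Prop}
    {φ : K → K'} (hφ : AdmMap adm adm' φ) {S : K → ℕ → ℕ → Formula L K'}
    (hS : ∀ k n i, adm' (φ k) (S k n i)) (k : K) (n : ℕ) (k' : K) (n' i : ℕ) :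
    adm' (φ k') (Formula.upFam φ k n S k' n' i) := by
  unfold Formula.upFam
  split_ifs
  · cases i with
    | zero => exact hφ.generic _ _ _
    | succ i =>
      simp only [shift₂_eq_substRen]
      exact hφ.substRen _ _ _ _ (hS _ _ _)
  · rw [shift₂_eq_substRen]
    exact hφ.substRen _ _ _ _ (hS _ _ _)

theorem AdmMap.shiftFam {adm : K → Formula L K → Prop} {adm' : K' → Formula L K' → Prop}
    {φ : K → K'} (hφ : AdmMap adm adm' φ) {S : K → ℕ → ℕ → Formula L K'}
    (hS : ∀ k n i, adm' (φ k) (S k n i)) (m : ℕ) (k : K) (n i : ℕ) :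
    adm' (φ k) (Formula.shiftFam m S k n i) :=
  hφ.substRen _ _ _ _ (hS k n i)

/-- Typings are preserved by the substitution of terms and formulas in the types. -/
theorem Typing.act {adm : K → Formula L K → Prop} {adm' : K' → Formula L K' → Prop}
    {φ : K → K'} (hφ : AdmMap adm adm' φ) {Γ : List (Formula L K)} {t : Lam} {A : Formula L K}
    (h : Typing Eqs adm Γ t A) (s : ℕ → L.Term ℕ) {S : K → ℕ → ℕ → Formula L K'}
    (hS : ∀ k n i, adm' (φ k) (S k n i)) :
    Typing Eqs adm' (Γ.map (Formula.act s φ S)) t (Formula.act s φ S A) := by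
  induction h generalizing s S with
  | var h => exact .var (by rw [List.getElem?_map, h]; rfl)
  | lam _ ih => exact .lam (ih s hS)
  | app _ _ ih₁ ih₂ => exact .app (ih₁ s hS) (ih₂ s hS)
  | all₁Intro _ ih =>
    refine .all₁Intro ?_
    have := ih (upSubst₁ s) (hφ.shiftFam hS 1)
    rw [List.map_map] at this ⊢
    convert this using 2
    funext B
    exact (act_shift₁ s φ S B).symm
  | all₁Elim a _ ih =>
    rw [act_inst₁]
    exact .all₁Elim _ (ih s hS)
  | @all₂Intro Γ t k n A _ ih =>
    refine .all₂Intro ?_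
    have := ih s (hφ.upFam hS k n)
    rw [List.map_map] at this ⊢
    convert this using 2
    funext B
    exact (act_shift₂ s φ S k n B).symm
  | all₂Elim G hG _ ih =>
    rw [act_inst₂]
    exact .all₂Elim _ (hφ.act _ _ _ _ (hφ.shiftFam hS _) hG) (ih s hS)
  | eq A hab _ ih =>
    rw [act_inst₁]
    refine .eq _ (hab.subst s) ?_
    rw [← act_inst₁]
    exact ih s hS

theorem Typing.substRen {adm : K → Formula L K → Prop} (hadm : AdmMap adm adm id)
    {Γ : List (Formula L K)} {t : Lam} {A : Formula L K} (h : Typing Eqs adm Γ t A)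
    (s : ℕ → L.Term ℕ) (ρ : K → ℕ → ℕ → ℕ) :
    Typing Eqs adm (Γ.map (Formula.substRen s ρ)) t (Formula.substRen s ρ A) := by
  have := h.act hadm s (S := fun k n i => Formula.generic k n (ρ k n i))
    fun k n i => hadm.generic k n _
  rw [← substRen_eq_act] at this
  convert this using 2
  funext B
  exact substRen_eq_act s ρ B

/-- Substitution of typed terms for the variables of a typed term. -/
theorem Typing.subst {adm : K → Formula L K → Prop} (hadm : AdmMap adm adm id)
    {Γ : List (Formula L K)} {t : Lam} {A : Formula L K} (h : Typing Eqs adm Γ t A)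
    {Δ : List (Formula L K)} {σ : ℕ → Lam}
    (hσ : ∀ i B, Γ[i]? = some B → Typing Eqs adm Δ (σ i) B) :
    Typing Eqs adm Δ (Lam.subst σ t) A := by
  induction h generalizing Δ σ with
  | var h => exact hσ _ _ h
  | lam _ ih =>
    refine .lam (ih fun i B hB => ?_)
    cases i with
    | zero => exact .var hB
    | succ i => exact (hσ i B hB).rename fun _ _ _ h => h
  | app _ _ ih₁ ih₂ => exact .app (ih₁ hσ) (ih₂ hσ)
  | all₁Intro _ ih =>
    refine .all₁Intro (ih fun i B hB => ?_)
    rw [List.getElem?_map, Option.map_eq_some_iff] at hB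
    obtain ⟨B', hB', rfl⟩ := hB
    have := (hσ i B' hB').substRen hadm (shiftVar L 1) idRen
    rw [← shift₁_eq] at this
    convert this using 2
    funext C
    exact shift₁_eq C
  | all₁Elim a _ ih => exact .all₁Elim a (ih hσ)
  | @all₂Intro Γ t k n A _ ih =>
    refine .all₂Intro (ih fun i B hB => ?_)
    rw [List.getElem?_map, Option.map_eq_some_iff] at hB
    obtain ⟨B', hB', rfl⟩ := hB
    have := (hσ i B' hB').substRen hadm FirstOrder.Language.Term.var (shiftRen k n)
    rw [← shift₂_eq_substRen] at this
    convert this using 2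
    funext C
    exact shift₂_eq_substRen _ _ C
  | all₂Elim G hG _ ih => exact .all₂Elim G hG (ih hσ)
  | eq A hab _ ih => exact .eq A hab (ih hσ)

/-! ### Equations between first order terms -/

/-- Two first order substitutions which differ by the replacement of a term by an equivalent
one. -/
def EqSubst (Eqs : Set (L.Term ℕ × L.Term ℕ)) (s s' : ℕ → L.Term ℕ) : Prop :=
  ∃ (r : ℕ → L.Term ℕ) (a b : L.Term ℕ), Approx Eqs a b ∧
    s = (fun i => (r i).subst (scons a FirstOrder.Language.Term.var)) ∧
    s' = fun i => (r i).subst (scons b FirstOrder.Language.Term.var)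

theorem shift_subst_scons (t a : L.Term ℕ) :
    (t.subst (shiftVar L 1)).subst (scons a FirstOrder.Language.Term.var) = t := by
  rw [term_subst_subst]
  exact term_subst_var t

theorem EqSubst.of_approx {a b : L.Term ℕ} (h : Approx Eqs a b) (s : ℕ → L.Term ℕ) :
    EqSubst Eqs (scons a s) (scons b s) := by
  refine ⟨scons (FirstOrder.Language.Term.var 0) fun i => (s i).subst (shiftVar L 1), a, b, h,
    ?_, ?_⟩ <;>
  · funext i
    rw [scons_subst]
    simp only [shift_subst_scons, FirstOrder.Language.Term.subst, scons]

theorem EqSubst.symm {s s' : ℕ → L.Term ℕ} (h : EqSubst Eqs s s') : EqSubst Eqs s' s := by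
  obtain ⟨r, a, b, hab, h₁, h₂⟩ := h
  exact ⟨r, b, a, hab.symm _ _, h₂, h₁⟩

theorem EqSubst.scons {s s' : ℕ → L.Term ℕ} (h : EqSubst Eqs s s') (c : L.Term ℕ) :
    EqSubst Eqs (scons c s) (scons c s') := by
  obtain ⟨r, a, b, hab, rfl, rfl⟩ := h
  refine ⟨StorageOp.scons (c.subst (shiftVar L 1)) r, a, b, hab, ?_, ?_⟩ <;>
  · funext i
    rw [scons_subst, shift_subst_scons]

theorem EqSubst.comp {s s' : ℕ → L.Term ℕ} (h : EqSubst Eqs s s') (q : ℕ → L.Term ℕ) :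
    EqSubst Eqs (fun i => (q i).subst s) fun i => (q i).subst s' := by
  obtain ⟨r, a, b, hab, rfl, rfl⟩ := h
  exact ⟨fun i => (q i).subst r, a, b, hab, by simp only [term_subst_subst],
    by simp only [term_subst_subst]⟩

theorem EqSubst.subst {s s' : ℕ → L.Term ℕ} (h : EqSubst Eqs s s') (q : ℕ → L.Term ℕ) :
    EqSubst Eqs (fun i => (s i).subst q) fun i => (s' i).subst q := by
  obtain ⟨r, a, b, hab, rfl, rfl⟩ := h
  refine ⟨fun i => (r i).subst (upSubst₁ q), a.subst q, b.subst q, hab.subst q, ?_, ?_⟩ <;>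
  · simp only [term_subst_subst]
    funext i
    congr 1
    funext j
    rw [upSubst₁_scons, scons_subst]
    simp only [FirstOrder.Language.Term.subst, term_subst_var]

theorem EqSubst.upSubst₁ {s s' : ℕ → L.Term ℕ} (h : EqSubst Eqs s s') :
    EqSubst Eqs (Formula.upSubst₁ s) (Formula.upSubst₁ s') := by
  have key : ∀ s : ℕ → L.Term ℕ, Formula.upSubst₁ s
      = StorageOp.scons (FirstOrder.Language.Term.var 0) fun i => (s i).subst (shiftVar L 1) := by
    intro s
    funext i
    cases i with
    | zero => rfl
    | succ i => exact term_relabel_eq_subst _ _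
  rw [key, key]
  exact (h.subst _).scons _

theorem Typing.eqSubst {adm : K' → Formula L K' → Prop} {Γ : List (Formula L K')} {t : Lam}
    {s s' : ℕ → L.Term ℕ} (h : EqSubst Eqs s s') {φ : K → K'} {S : K → ℕ → ℕ → Formula L K'}
    {A : Formula L K} (ht : Typing Eqs adm Γ t (Formula.act s φ S A)) :
    Typing Eqs adm Γ t (Formula.act s' φ S A) := by
  obtain ⟨r, a, b, hab, rfl, rfl⟩ := h
  rw [← inst₁_act] at ht ⊢
  exact .eq _ hab ht

theorem Typing.eqSubst' {adm : K → Formula L K → Prop} {Γ : List (Formula L K)} {t : Lam}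
    {s s' : ℕ → L.Term ℕ} (h : EqSubst Eqs s s')
    {A : Formula L K} (ht : Typing Eqs adm Γ t (Formula.substRen s idRen A)) :
    Typing Eqs adm Γ t (Formula.substRen s' idRen A) := by
  rw [substRen_eq_act] at ht ⊢
  exact ht.eqSubst h

/-! ### Subject reduction -/

/-- What a typing `Γ ⊢ λx t : A` says about `t`: quantifiers are stripped from `A` until an
implication `B → C` is met, with `Γ, x : B ⊢ t : C`. -/
def LamTyping (Eqs : Set (L.Term ℕ × L.Term ℕ)) (adm : K → Formula L K → Prop) (t : Lam) :
    List (Formula L K) → Formula L K → Prop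
  | Γ, .imp A B => Typing Eqs adm (A :: Γ) t B
  | Γ, .all₁ A => LamTyping Eqs adm t (Γ.map shift₁) A
  | Γ, .all₂ k n A => LamTyping Eqs adm t (Γ.map (shift₂ k n)) A
  | _, .bot => False
  | _, .rel _ _ _ => False
  | _, .pvar _ _ _ _ => False

theorem LamTyping.act {adm : K → Formula L K → Prop} (hadm : AdmMap adm adm id) {t : Lam}
    {Γ : List (Formula L K)} {A : Formula L K} (h : LamTyping Eqs adm t Γ A) (s : ℕ → L.Term ℕ)
    {S : K → ℕ → ℕ → Formula L K} (hS : ∀ k n i, adm k (S k n i)) :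
    LamTyping Eqs adm t (Γ.map (Formula.act s id S)) (Formula.act s id S A) := by
  induction A generalizing Γ s S with
  | bot => exact h
  | rel => exact h
  | pvar => exact h.elim
  | imp A B => exact Typing.act hadm h s hS
  | all₁ A ih =>
    have := ih h (upSubst₁ s) (hadm.shiftFam hS 1)
    simp only [LamTyping, Formula.act]
    rw [List.map_map] at this ⊢
    convert this using 2
    funext B
    exact (act_shift₁ s id S B).symm
  | all₂ k n A ih =>
    have := ih h s (hadm.upFam hS k n)
    simp only [LamTyping, Formula.act]
    rw [List.map_map] at this ⊢
    convert this using 2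
    funext B
    exact (act_shift₂ s id S k n B).symm

theorem LamTyping.eqSubst {adm : K → Formula L K → Prop} (hadm : AdmMap adm adm id) {t : Lam}
    {Γ : List (Formula L K)} {A : Formula L K} {s s' : ℕ → L.Term ℕ} (hs : EqSubst Eqs s s')
    (h : LamTyping Eqs adm t Γ (Formula.substRen s idRen A)) :
    LamTyping Eqs adm t Γ (Formula.substRen s' idRen A) := by
  induction A generalizing Γ s s' with
  | bot => exact h
  | rel => exact h
  | pvar => exact h
  | imp A B =>
    have h₁ : Typing Eqs adm (Formula.substRen s' idRen A :: Γ) t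
        (Formula.substRen s idRen B) := by
      have := Typing.subst hadm h (Δ := Formula.substRen s' idRen A :: Γ) (σ := .var) ?_
      · rwa [Lam.subst_var] at this
      · intro i C hC
        cases i with
        | zero =>
          cases hC
          exact Typing.eqSubst' hs.symm (.var rfl)
        | succ i => exact .var hC
    exact h₁.eqSubst' hs
  | all₁ A ih => exact ih hs.upSubst₁ h
  | all₂ k n A ih =>
    simp only [LamTyping, Formula.substRen, upRen₂_idRen] at h ⊢
    exact ih hs h

/-- Inversion of a typing of an abstraction. -/
theorem Typing.lamTyping {adm : K → Formula L K → Prop} (hadm : AdmMap adm adm id) {t : Lam}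
    {Γ : List (Formula L K)} {A : Formula L K} (h : Typing Eqs adm Γ (.lam t) A) :
    LamTyping Eqs adm t Γ A := by
  generalize hu : Lam.lam t = u at h
  induction h with
  | var _ => cases hu
  | lam h _ => cases hu; exact h
  | app _ _ _ _ => cases hu
  | all₁Intro _ ih => exact ih hu
  | @all₁Elim Γ _ A a _ ih =>
    have h : LamTyping Eqs adm t (Γ.map shift₁) A := ih hu
    have := h.act hadm (scons a FirstOrder.Language.Term.var)
      (S := fun k n i => Formula.generic k n i) fun k n i => hadm.generic k n i
    rw [inst₁_eq, substRen_eq_act]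
    convert this using 1
    rw [List.map_map]
    conv_lhs => rw [← List.map_id Γ]
    congr 1
    funext B
    simp only [Function.comp]
    rw [shift₁_eq, ← substRen_eq_act _ idRen, substRen_substRen]
    exact (substRen_var B).symm
  | all₂Intro _ ih => exact ih hu
  | @all₂Elim Γ _ k n A G hG _ ih =>
    have h : LamTyping Eqs adm t (Γ.map (shift₂ k n)) A := ih hu
    have := h.act hadm FirstOrder.Language.Term.var
      (S := consFam k n G fun k n i => Formula.generic k n i) fun k' n' i => by
        unfold consFam
        split_ifs with h
        · cases i with
          | zero => rw [h.1]; exact hG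
          | succ i => exact hadm.generic _ _ _
        · exact hadm.generic _ _ _
    rw [inst₂_eq]
    convert this using 1
    rw [List.map_map]
    conv_lhs => rw [← List.map_id Γ]
    congr 1
    funext B
    simp only [Function.comp]
    rw [shift₂_eq_substRen, act_substRen]
    simp only [term_subst_var, consFam_shiftRen]
    exact (act_var_generic B).symm
  | eq A hab _ ih =>
    have := ih hu
    rw [inst₁_eq] at this ⊢
    exact this.eqSubst hadm (EqSubst.of_approx hab _)

theorem Typing.betaStep {adm : K → Formula L K → Prop} (hadm : AdmMap adm adm id)
    {Γ : List (Formula L K)} {t u : Lam} {A : Formula L K} (h : Typing Eqs adm Γ t A)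
    (hu : t.BetaStep u) : Typing Eqs adm Γ u A := by
  induction h generalizing u with
  | var _ => cases hu
  | lam _ ih =>
    cases hu with
    | lam hu => exact .lam (ih hu)
  | @app Γ t s A B h₁ h₂ ih₁ ih₂ =>
    cases hu with
    | beta t s =>
      have h₃ : Typing Eqs adm (A :: Γ) t B := h₁.lamTyping hadm
      rw [Lam.inst_eq_subst]
      refine h₃.subst hadm fun i C hC => ?_
      cases i with
      | zero => cases hC; exact h₂
      | succ i => exact .var hC
    | appLeft _ hu => exact .app (ih₁ hu) h₂
    | appRight _ hu => exact .app h₁ (ih₂ hu)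
  | all₁Intro _ ih => exact .all₁Intro (ih hu)
  | all₁Elim a _ ih => exact .all₁Elim a (ih hu)
  | all₂Intro _ ih => exact .all₂Intro (ih hu)
  | all₂Elim G hG _ ih => exact .all₂Elim G hG (ih hu)
  | eq A hab _ ih => exact .eq A hab (ih hu)

theorem Typing.betaRed {adm : K → Formula L K → Prop} (hadm : AdmMap adm adm id)
    {Γ : List (Formula L K)} {t u : Lam} {A : Formula L K} (h : Typing Eqs adm Γ t A)
    (hu : Relation.ReflTransGen Lam.BetaStep t u) : Typing Eqs adm Γ u A := by
  induction hu with
  | refl => exact h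
  | tail _ hu ih => exact ih.betaStep hadm hu

end StorageOp

namespace StorageOp

open Formula

/-! ### Realizability -/

variable {L : FirstOrder.Language.{u, v}} {K : Type} [DecidableEq K] {C : Type}
  {Eqs : Set (L.Term ℕ × L.Term ℕ)}

/-- The sets of terms closed under weak head expansion. -/
def HeadClosed (X : Set (Tm C)) : Prop := ∀ t t', Tm.Spine t t' → t' ∈ X → t ∈ X

/-- The data of a realizability interpretation. The argument of a realizer of `A → B` has to be a
realizer of `A` which satisfies in addition the condition `syn A`. A second order
variable of sort `k` ranges over pairs of a formula `G` with `adm k G` and of a predicate with values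
in `cand k`. -/
structure Model (L : FirstOrder.Language.{u, v}) (K C : Type) where
  adm : K → Formula L K → Prop
  syn : Formula L K → Tm C → Prop
  bot : Set (Tm C)
  rel : (n : ℕ) → L.Relations n → Set (Tm C)
  cand : K → Set (Tm C) → Prop

/-- A predicate on first order terms with values in the sets of terms. A predicate of arity `n`
depends only on the first `n` terms of the sequence. -/
abbrev TmPred (L : FirstOrder.Language.{u, v}) (C : Type) := (ℕ → L.Term ℕ) → Set (Tm C)

namespace Model

variable (Eqs) in
/-- The predicates over which a second order variable of arity `n` and sort `k` ranges. -/
structure Good (M : Model L K C) (k : K) (n : ℕ) (Q : TmPred L C) : Prop where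
  cand : ∀ e, M.cand k (Q e)
  arity : ∀ e e', (∀ j < n, e j = e' j) → Q e = Q e'
  eqSubst : ∀ e e', EqSubst Eqs e e' → Q e = Q e'

variable (Eqs) in
/-- The realizers of a formula. The free first order variables are interpreted by the terms `s`,
the free second order variables by the formulas `S` and the predicates `P`. -/
def Sem (M : Model L K C) : Formula L K → (ℕ → L.Term ℕ) → (K → ℕ → ℕ → Formula L K) →
    (K → ℕ → ℕ → TmPred L C) → Set (Tm C)
  | .bot, _, _, _ => M.bot
  | .rel n R _, _, _, _ => M.rel n R
  | .pvar k n i ts, s, _, P => P k n i (args fun j => (ts j).subst s)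
  | .imp A B, s, S, P =>
    {t | ∀ a ∈ Sem M A s S P, M.syn (act s id S A) a → Tm.app t a ∈ Sem M B s S P}
  | .all₁ A, s, S, P => {t | ∀ a, t ∈ Sem M A (scons a s) S P}
  | .all₂ k n A, s, S, P =>
    {t | ∀ G Q, M.adm k G → M.Good Eqs k n Q → t ∈ Sem M A s (consFam k n G S) (consFam k n Q P)}

variable (Eqs) in
/-- An admissible interpretation of the second order variables. -/
structure Valid (M : Model L K C) (S : K → ℕ → ℕ → Formula L K)
    (P : K → ℕ → ℕ → TmPred L C) : Prop where
  adm : ∀ k n i, M.adm k (S k n i)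
  good : ∀ k n i, M.Good Eqs k n (P k n i)

theorem Valid.cons {M : Model L K C} {S : K → ℕ → ℕ → Formula L K} {P : K → ℕ → ℕ → TmPred L C}
    (h : M.Valid Eqs S P) {k : K} {n : ℕ} {G : Formula L K} {Q : TmPred L C} (hG : M.adm k G)
    (hQ : M.Good Eqs k n Q) : M.Valid Eqs (consFam k n G S) (consFam k n Q P) where
  adm k' n' i := by
    unfold consFam
    split_ifs with h'
    · cases i with
      | zero => exact h'.1 ▸ hG
      | succ i => exact h.adm _ _ _
    · exact h.adm _ _ _
  good k' n' i := by
    unfold consFam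
    split_ifs with h'
    · obtain ⟨rfl, rfl⟩ := h'
      cases i with
      | zero => exact hQ
      | succ i => exact h.good _ _ _
    · exact h.good _ _ _

variable (Eqs) in
/-- The conditions under which the typing rules are sound for a realizability interpretation. -/
structure Sound (M : Model L K C) : Prop where
  admMap : AdmMap M.adm M.adm id
  bot_headClosed : HeadClosed M.bot
  rel_headClosed : ∀ n R, HeadClosed (M.rel n R)
  cand_headClosed : ∀ k X, M.cand k X → HeadClosed X
  cand_sem : ∀ k G s S P, M.adm k G → M.Valid Eqs S P → M.cand k (M.Sem Eqs G s S P)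
  syn_eqSubst : ∀ A s s' S a, EqSubst Eqs s s' → M.syn (act s id S A) a → M.syn (act s' id S A) a
  syn_typing : ∀ Γ t A s S σ, Typing Eqs M.adm Γ t A → (∀ k n i, M.adm k (S k n i)) →
    (∀ i B, Γ[i]? = some B → M.syn (act s id S B) (σ i)) →
    M.syn (act s id S A) (Tm.subst σ t.toTm)

variable {M : Model L K C}

theorem consFam_upRen₂ {α : Type*} (k : K) (n : ℕ) (ρ : K → ℕ → ℕ → ℕ) (G : α)
    (S : K → ℕ → ℕ → α) (k' : K) (n' i : ℕ) :
    consFam k n G S k' n' (upRen₂ k n ρ k' n' i)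
      = consFam k n G (fun k n i => S k n (ρ k n i)) k' n' i := by
  unfold consFam upRen₂
  split_ifs
  · cases i <;> rfl
  · rfl

theorem sem_substRen (A : Formula L K) (r s : ℕ → L.Term ℕ) (ρ : K → ℕ → ℕ → ℕ)
    (S : K → ℕ → ℕ → Formula L K) (P : K → ℕ → ℕ → TmPred L C) :
    M.Sem Eqs (substRen r ρ A) s S P
      = M.Sem Eqs A (fun i => (r i).subst s) (fun k n i => S k n (ρ k n i))
          (fun k n i => P k n (ρ k n i)) := by
  induction A generalizing r s ρ S P with
  | bot => rfl
  | rel => rfl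
  | pvar => simp only [substRen, Sem, term_subst_subst]
  | imp A B ihA ihB => simp only [substRen, Sem, ihA, ihB, act_substRen]
  | all₁ A ih =>
    simp only [substRen, Sem, ih, upSubst₁_scons]
  | all₂ k n A ih =>
    simp only [substRen, Sem, ih, consFam_upRen₂]

/-- The terms `e 0, …, e (n - 1)` for the parameters of a formula, followed by `s`. -/
def paramEnv (n : ℕ) (e s : ℕ → L.Term ℕ) (j : ℕ) : L.Term ℕ := if j < n then e j else s (j - n)

theorem paramEnv_args {n : ℕ} (ts : Fin n → L.Term ℕ) (s r : ℕ → L.Term ℕ) :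
    paramEnv n (args fun j => (ts j).subst fun i => (r i).subst s) s
      = fun j => (args (fun j => (ts j).subst r) j).subst s := by
  funext j
  unfold paramEnv args
  split_ifs
  · exact (term_subst_subst _ _ _).symm
  · rfl

theorem args_paramEnv (n : ℕ) (e s : ℕ → L.Term ℕ) (j : ℕ) (hj : j < n) :
    args (fun j : Fin n => (FirstOrder.Language.Term.var (j : ℕ)).subst (paramEnv n e s)) j
      = e j := by
  simp [args, hj, FirstOrder.Language.Term.subst, paramEnv]

theorem sem_generic (k : K) (n i : ℕ) (e s : ℕ → L.Term ℕ) (S : K → ℕ → ℕ → Formula L K)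
    (P : K → ℕ → ℕ → TmPred L C) (hP : M.Good Eqs k n (P k n i)) :
    M.Sem Eqs (generic k n i) (paramEnv n e s) S P = P k n i e :=
  hP.arity _ _ fun j hj => args_paramEnv n e s j hj

theorem act_shift₂_consFam (k : K) (n : ℕ) (m : ℕ) (G : Formula L K)
    (S : K → ℕ → ℕ → Formula L K) (s : ℕ → L.Term ℕ) (H : Formula L K) :
    act s id (shiftFam m (consFam k n G S)) (shift₂ k n H) = act s id (shiftFam m S) H := by
  rw [shift₂_eq_substRen, act_substRen]
  simp only [shiftFam, FirstOrder.Language.Term.subst, consFam_shiftRen]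
  rfl

theorem sem_shift₂ (k : K) (n : ℕ) (G : Formula L K) (Q : TmPred L C) (s : ℕ → L.Term ℕ)
    (S : K → ℕ → ℕ → Formula L K) (P : K → ℕ → ℕ → TmPred L C) (A : Formula L K) :
    M.Sem Eqs (shift₂ k n A) s (consFam k n G S) (consFam k n Q P) = M.Sem Eqs A s S P := by
  rw [shift₂_eq_substRen, sem_substRen]
  simp only [FirstOrder.Language.Term.subst, consFam_shiftRen]

theorem sem_act (A : Formula L K) (r s : ℕ → L.Term ℕ) (R S : K → ℕ → ℕ → Formula L K)
    (P : K → ℕ → ℕ → TmPred L C) :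
    M.Sem Eqs (act r id R A) s S P
      = M.Sem Eqs A (fun i => (r i).subst s)
          (fun k n i => act (liftArgs n s) id (shiftFam n S) (R k n i))
          (fun k n i e => M.Sem Eqs (R k n i) (paramEnv n e s) S P) := by
  induction A generalizing r s R S P with
  | bot => rfl
  | rel => rfl
  | pvar => simp only [act, Sem, sem_substRen, paramEnv_args]
  | imp A B ihA ihB => simp only [act, Sem, ihA, ihB, act_act, Function.id_comp]
  | all₁ A ih =>
    simp only [act, Sem, ih, upSubst₁_scons]
    ext t
    refine forall_congr' fun a => ?_
    have h₁ : (fun k n i => act (liftArgs n (scons a s)) id (shiftFam n S) (shiftFam 1 R k n i))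
        = fun k n i => act (liftArgs n s) id (shiftFam n S) (R k n i) := by
      funext k n i
      unfold shiftFam
      rw [act_substRen]
      simp only [liftArgs_subst]
      rfl
    have h₂ : (fun k n i e => M.Sem Eqs (shiftFam 1 R k n i) (paramEnv n e (scons a s)) S P)
        = fun k n i e => M.Sem Eqs (R k n i) (paramEnv n e s) S P := by
      funext k n i e
      unfold shiftFam
      rw [sem_substRen]
      congr 1
      funext j
      unfold liftArgs paramEnv
      split_ifs with h
      · simp [FirstOrder.Language.Term.subst, h]
      · simp [FirstOrder.Language.Term.subst, shiftVar, scons]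
    rw [h₁, h₂]
  | all₂ k n A ih =>
    simp only [act, Sem, ih]
    ext t
    refine forall₄_congr fun G Q _ hQ => ?_
    have h₁ : (fun k' n' i => act (liftArgs n' s) id (shiftFam n' (consFam k n G S))
          (upFam id k n R k' n' i))
        = consFam k n G fun k n i => act (liftArgs n s) id (shiftFam n S) (R k n i) := by
      funext k' n' i
      by_cases h : k' = k ∧ n' = n
      · obtain ⟨rfl, rfl⟩ := h
        cases i with
        | zero =>
          have := act_generic_shiftFam n' s id (consFam k' n' G S) k' 0
          simpa [consFam, upFam] using this
        | succ i =>
          simp only [consFam, upFam, and_self, if_true]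
          exact act_shift₂_consFam _ _ _ _ _ _ _
      · simp only [upFam, h, if_false, id]
        rw [act_shift₂_consFam]
        simp only [consFam, h, if_false]
    have h₂ : (fun k' n' i e => M.Sem Eqs (upFam id k n R k' n' i) (paramEnv n' e s)
          (consFam k n G S) (consFam k n Q P))
        = consFam k n Q fun k n i e => M.Sem Eqs (R k n i) (paramEnv n e s) S P := by
      funext k' n' i e
      by_cases h : k' = k ∧ n' = n
      · obtain ⟨rfl, rfl⟩ := h
        cases i with
        | zero =>
          have := sem_generic (M := M) (Eqs := Eqs) k' n' 0 e s (consFam k' n' G S)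
            (consFam k' n' Q P) (by simpa [consFam] using hQ)
          simpa [consFam, upFam] using this
        | succ i =>
          simp only [upFam, and_self, if_true, id]
          rw [sem_shift₂]
          simp [consFam]
      · simp only [upFam, h, if_false, id]
        rw [sem_shift₂]
        simp only [consFam, h, if_false]
    exact iff_of_eq (congrArg₂ (fun X Y => t ∈ M.Sem Eqs A _ X Y) h₁ h₂)

theorem sem_headClosed (hbot : HeadClosed M.bot) (hrel : ∀ n R, HeadClosed (M.rel n R))
    (hcand : ∀ k X, M.cand k X → HeadClosed X) (A : Formula L K) (s : ℕ → L.Term ℕ)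
    {S : K → ℕ → ℕ → Formula L K} {P : K → ℕ → ℕ → TmPred L C} (h : M.Valid Eqs S P) :
    HeadClosed (M.Sem Eqs A s S P) := by
  induction A generalizing s S P with
  | bot => exact hbot
  | rel n R _ => exact hrel n R
  | pvar k n i ts => exact hcand k _ ((h.good k n i).cand _)
  | imp A B _ ihB =>
    intro t t' htt' ht' a ha hsyn
    exact ihB s h _ _ (.app a htt') (ht' a ha hsyn)
  | all₁ A ih =>
    intro t t' htt' ht' a
    exact ih _ h _ _ htt' (ht' a)
  | all₂ k n A ih =>
    intro t t' htt' ht' G Q hG hQ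
    exact ih _ (h.cons hG hQ) _ _ htt' (ht' G Q hG hQ)

theorem sem_eqSubst (hM : M.Sound Eqs) (A : Formula L K) {s s' : ℕ → L.Term ℕ}
    (hs : EqSubst Eqs s s') {S : K → ℕ → ℕ → Formula L K} {P : K → ℕ → ℕ → TmPred L C}
    (h : M.Valid Eqs S P) : M.Sem Eqs A s S P = M.Sem Eqs A s' S P := by
  induction A generalizing s s' S P with
  | bot => rfl
  | rel n R _ => rfl
  | pvar k n i ts =>
    have key : ∀ r : ℕ → L.Term ℕ, P k n i (args fun j => (ts j).subst r)
        = P k n i fun j => (args ts j).subst r := fun r =>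
      (h.good k n i).arity _ _ fun j hj => by simp [args, hj]
    exact (key s).trans (((h.good k n i).eqSubst _ _ (hs.comp _)).trans (key s').symm)
  | imp A B ihA ihB =>
    simp only [Sem, ihA hs h, ihB hs h]
    ext t
    exact forall₂_congr fun a _ => imp_congr_left
      ⟨hM.syn_eqSubst A _ _ S a hs, hM.syn_eqSubst A _ _ S a hs.symm⟩
  | all₁ A ih =>
    ext t
    exact forall_congr' fun a => by rw [ih (hs.scons a) h]
  | all₂ k n A ih =>
    ext t
    exact forall₄_congr fun G Q hG hQ => by rw [ih hs (h.cons hG hQ)]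

theorem eqSubst_paramEnv (n : ℕ) {e e' : ℕ → L.Term ℕ} (s : ℕ → L.Term ℕ)
    (h : EqSubst Eqs e e') : EqSubst Eqs (paramEnv n e s) (paramEnv n e' s) := by
  obtain ⟨r, a, b, hab, rfl, rfl⟩ := h
  refine ⟨paramEnv n r fun j => (s j).subst (shiftVar L 1), a, b, hab, ?_, ?_⟩ <;>
  · funext j
    unfold paramEnv
    split_ifs
    · rfl
    · rw [shift_subst_scons]

theorem good_sem (hM : M.Sound Eqs) {k : K} (n : ℕ) {G : Formula L K} (hG : M.adm k G)
    (s : ℕ → L.Term ℕ) {S : K → ℕ → ℕ → Formula L K} {P : K → ℕ → ℕ → TmPred L C}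
    (h : M.Valid Eqs S P) :
    M.Good Eqs k n fun e => M.Sem Eqs G (paramEnv n e s) S P where
  cand e := hM.cand_sem k G _ S P hG h
  arity e e' he := by
    have : paramEnv n e s = paramEnv n e' s := by
      funext j
      unfold paramEnv
      split_ifs with hj
      · exact he j hj
      · rfl
    simp only [this]
  eqSubst e e' he := sem_eqSubst hM G (eqSubst_paramEnv n s he) h

/-- Soundness of the typing rules: a typed term, with realizers substituted for its variables,
realizes its type. -/
theorem adequacy (hM : M.Sound Eqs) {Γ : List (Formula L K)} {t : Lam} {A : Formula L K}
    (ht : Typing Eqs M.adm Γ t A) (s : ℕ → L.Term ℕ) {S : K → ℕ → ℕ → Formula L K}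
    {P : K → ℕ → ℕ → TmPred L C} (h : M.Valid Eqs S P) {σ : ℕ → Tm C}
    (hσ : ∀ i B, Γ[i]? = some B → σ i ∈ M.Sem Eqs B s S P ∧ M.syn (act s id S B) (σ i)) :
    Tm.subst σ t.toTm ∈ M.Sem Eqs A s S P := by
  induction ht generalizing s S P σ with
  | var hi => exact (hσ _ _ hi).1
  | lam _ ih =>
    intro a ha hsyn
    refine sem_headClosed hM.bot_headClosed hM.rel_headClosed hM.cand_headClosed _ s h _ _ (.beta _ _) ?_
    rw [Tm.subst_upSubst_inst]
    refine ih s h fun i B hB => ?_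
    cases i with
    | zero => cases hB; exact ⟨ha, hsyn⟩
    | succ i => exact hσ i B hB
  | app _ h₂ ih₁ ih₂ =>
    exact ih₁ s h hσ _ (ih₂ s h hσ)
      (hM.syn_typing _ _ _ _ _ _ h₂ h.adm fun i B hB => (hσ i B hB).2)
  | all₁Intro _ ih =>
    intro a
    refine ih (scons a s) h fun i B hB => ?_
    rw [List.getElem?_map, Option.map_eq_some_iff] at hB
    obtain ⟨B', hB', rfl⟩ := hB
    rw [shift₁_eq, sem_substRen, act_substRen]
    exact hσ i B' hB'
  | all₁Elim a _ ih =>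
    rw [inst₁_eq, sem_substRen]
    have := ih s h hσ (a.subst s)
    simp only [scons_subst]
    exact this
  | @all₂Intro Γ t k n A _ ih =>
    intro G Q hG hQ
    refine ih s (h.cons hG hQ) fun i B hB => ?_
    rw [List.getElem?_map, Option.map_eq_some_iff] at hB
    obtain ⟨B', hB', rfl⟩ := hB
    rw [sem_shift₂, shift₂_eq_substRen, act_substRen]
    simp only [consFam_shiftRen]
    exact hσ i B' hB'
  | @all₂Elim Γ t k n A G hG _ ih =>
    rw [inst₂_eq, sem_act]
    have := ih s h hσ _ _ (hM.admMap.act (liftArgs n s) _ k G (hM.admMap.shiftFam h.adm n) hG)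
      (good_sem hM n hG s h)
    convert this using 2
    · rfl
    · funext k' n' i
      unfold consFam
      split_ifs with hk
      · obtain ⟨rfl, rfl⟩ := hk
        cases i with
        | zero => rfl
        | succ i => exact act_generic_shiftFam _ _ _ _ _ _
      · exact act_generic_shiftFam _ _ _ _ _ _
    · funext k' n' i e
      unfold consFam
      split_ifs with hk
      · obtain ⟨rfl, rfl⟩ := hk
        cases i with
        | zero => rfl
        | succ i => exact sem_generic _ _ _ _ _ _ _ (h.good _ _ _)
      · exact sem_generic _ _ _ _ _ _ _ (h.good _ _ _)
  | eq A hab _ ih =>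
    have := ih s h hσ
    rw [inst₁_eq, sem_substRen] at this ⊢
    rwa [sem_eqSubst hM A ((EqSubst.of_approx hab _).subst s) h] at this

end Model

end StorageOp

namespace StorageOp

open Formula

/-! ### Reduction to pure terms -/

namespace Tm

variable {C : Type}

/-- The terms which reduce to a term without constants. -/
def PureRed (C : Type) : Set (Tm C) := {t | ∃ v : Lam, Red t v.toTm}

theorem headClosed_pureRed : HeadClosed (PureRed C) := by
  rintro t t' h ⟨v, hv⟩
  exact ⟨v, .head h.step hv⟩

theorem toTm_injective : Function.Injective (Lam.toTm : Lam → Tm C) := by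
  intro t u h
  rw [← eval_toTm (fun _ : C => .var 0) t, h, eval_toTm]

theorem exists_toTm_of_rename {ρ : ℕ → ℕ} {w : Tm C} {v : Lam} (h : rename ρ w = v.toTm) :
    ∃ v' : Lam, w = v'.toTm := by
  induction w generalizing ρ v with
  | var i => exact ⟨.var i, rfl⟩
  | const c => cases v <;> cases h
  | app w₁ w₂ ih₁ ih₂ =>
    cases v with
    | app v₁ v₂ =>
      injection h with h₁ h₂
      obtain ⟨v₁', rfl⟩ := ih₁ h₁
      obtain ⟨v₂', rfl⟩ := ih₂ h₂
      exact ⟨.app v₁' v₂', rfl⟩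
    | _ => cases h
  | lam w ih =>
    cases v with
    | lam v =>
      injection h with h
      obtain ⟨v', rfl⟩ := ih h
      exact ⟨.lam v', rfl⟩
    | _ => cases h

theorem Red.app_var_cases {t w : Tm C} {i : ℕ} (h : Red (Tm.app t (var i)) w) :
    (∃ u, w = Tm.app u (var i) ∧ Red t u) ∨ ∃ b, Red t (Tm.lam b) ∧ Red (b.inst (var i)) w := by
  induction h with
  | refl => exact .inl ⟨t, rfl, .refl⟩
  | tail _ h ih =>
    rcases ih with ⟨u, rfl, hu⟩ | ⟨b, hb, hw⟩
    · cases h with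
      | beta b _ => exact .inr ⟨b, hu, .refl⟩
      | appLeft _ h => exact .inl ⟨_, rfl, hu.tail h⟩
      | appRight _ h => cases h
    · exact .inr ⟨b, hb, hw.tail h⟩

/-- If `t x` reduces to a pure term, so does `t`. The variable `x` may occur in `t`, since only the
absence of constants has to be traced back. -/
theorem pureRed_of_app_var {t : Tm C} {i : ℕ} (h : Tm.app t (var i) ∈ PureRed C) :
    t ∈ PureRed C := by
  obtain ⟨v, hv⟩ := h
  rcases hv.app_var_cases with ⟨u, hu, htu⟩ | ⟨b, hb, hv⟩
  · cases v with
    | app v₁ v₂ =>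
      injection hu with hu _
      exact ⟨v₁, hu ▸ htu⟩
    | _ => cases hu
  · have hren : b.inst (var i) = Tm.rename (scons i id) b := by
      rw [rename_eq_subst]
      unfold inst
      congr 1
      funext j; cases j <;> rfl
    rw [hren] at hv
    obtain ⟨b', hb', hv'⟩ := hv.of_rename
    obtain ⟨v', rfl⟩ := exists_toTm_of_rename hv'.symm
    exact ⟨.lam v', hb.trans hb'.lam⟩

/-- The terms `x t₁ … tₙ`, with a variable `x` and arguments which reduce to pure terms. -/
inductive Neutral : Tm C → Prop
  | var (i : ℕ) : Neutral (var i)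
  | app {t a : Tm C} : Neutral t → a ∈ PureRed C → Neutral (app t a)

theorem Neutral.mem_pureRed {t : Tm C} (h : Neutral t) : t ∈ PureRed C := by
  induction h with
  | var i => exact ⟨.var i, .refl⟩
  | app _ ha ih =>
    obtain ⟨v, hv⟩ := ih
    obtain ⟨w, hw⟩ := ha
    exact ⟨.app v w, hv.app hw⟩

end Tm

theorem Lam.HasFree.of_rename {ρ : ℕ → ℕ} {t : Lam} {i : ℕ} (h : (Lam.rename ρ t).HasFree i) :
    ∃ j, ρ j = i := by
  induction t generalizing ρ i with
  | var j => exact ⟨j, h⟩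
  | app t s iht ihs => exact h.elim (fun h => iht h) fun h => ihs h
  | lam t ih =>
    obtain ⟨j, hj⟩ := ih h
    cases j with
    | zero => simp [Lam.upRen] at hj
    | succ j => exact ⟨j, by simpa [Lam.upRen] using hj⟩

/-! ### The types of the extended system -/

variable {L : FirstOrder.Language.{u, v}} {Eqs : Set (L.Term ℕ × L.Term ℕ)} {C : Type}

theorem isBotType_substRen {A : ExtType L} (h : IsBotType A) (s : ℕ → L.Term ℕ)
    (ρ : VarSort → ℕ → ℕ → ℕ) : IsBotType (substRen s ρ A) := by
  induction A generalizing s ρ with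
  | bot => trivial
  | rel => exact h
  | pvar => exact h
  | imp A B _ ih => exact ih h s ρ
  | all₁ A ih => exact ih h _ ρ
  | all₂ k n A ih => exact ih h s _

/-- The formulas which may be substituted for the variables of a sort in `AF2_⊥`. -/
abbrev ExtAdm (k : VarSort) (G : ExtType L) : Prop := k = VarSort.special → IsBotType G

theorem extAdm_upFam {S : VarSort → ℕ → ℕ → ExtType L} (hS : ∀ k n i, ExtAdm k (S k n i))
    (k : VarSort) (n : ℕ) (k' : VarSort) (n' i : ℕ) : ExtAdm k' (upFam id k n S k' n' i) := by
  intro hk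
  unfold upFam
  split_ifs
  · cases i with
    | zero => exact hk
    | succ i =>
      simp only [shift₂_eq_substRen]
      exact isBotType_substRen (hS _ _ _ hk) _ _
  · rw [shift₂_eq_substRen]
    exact isBotType_substRen (hS _ _ _ hk) _ _

theorem isBotType_act {A : ExtType L} (h : IsBotType A) (s : ℕ → L.Term ℕ)
    {S : VarSort → ℕ → ℕ → ExtType L} (hS : ∀ k n i, ExtAdm k (S k n i)) :
    IsBotType (act s id S A) := by
  induction A generalizing s S with
  | bot => trivial
  | rel => exact h
  | pvar => exact isBotType_substRen (hS _ _ _ h) _ _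
  | imp A B _ ih => exact ih h s hS
  | all₁ A ih => exact ih h _ fun k n i hk => isBotType_substRen (hS k n i hk) _ _
  | all₂ k n A ih => exact ih h s (extAdm_upFam hS k n)

theorem admMap_extAdm : AdmMap (ExtAdm (L := L)) ExtAdm id where
  act s _ _ _ hS hG hk := isBotType_act (hG hk) s hS
  generic _ _ _ hk := hk
  substRen s ρ _ _ hG hk := isBotType_substRen (hG hk) s ρ

/-- The types which end with `⊥`, with a special variable, or with one of the predicate symbols
in `Rels`. -/
def EndsIn (Rels : (n : ℕ) → L.Relations n → Prop) : ExtType L → Prop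
  | .bot => True
  | .rel n R _ => Rels n R
  | .pvar k _ _ _ => k = VarSort.special
  | .imp _ B => EndsIn Rels B
  | .all₁ A => EndsIn Rels A
  | .all₂ _ _ A => EndsIn Rels A

theorem IsBotType.endsIn (Rels : (n : ℕ) → L.Relations n → Prop) {A : ExtType L}
    (h : IsBotType A) : EndsIn Rels A := by
  induction A with
  | bot => trivial
  | rel => exact h.elim
  | pvar => exact h
  | imp A B _ ih => exact ih h
  | all₁ A ih => exact ih h
  | all₂ k n A ih => exact ih h

/-! ### Terms of an ordinary type do not use variables of `⊥`-types -/

/-- In this interpretation, every term realizes the types which end with `⊥`, with a special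
variable or with a symbol in `Rels`, and the other symbols are interpreted by the terms which
reduce to pure terms. -/
def pureModel (Rels : (n : ℕ) → L.Relations n → Prop) (C : Type) : Model L VarSort C where
  adm := ExtAdm
  syn _ _ := True
  bot := Set.univ
  rel n R := {t | Rels n R ∨ t ∈ Tm.PureRed C}
  cand k X := HeadClosed X ∧ (k = VarSort.special → X = Set.univ)

variable {Rels : (n : ℕ) → L.Relations n → Prop}

theorem headClosed_univ : HeadClosed (Set.univ : Set (Tm C)) := fun _ _ _ _ => trivial

theorem pureModel_sem_of_endsIn {A : ExtType L} (hA : EndsIn Rels A) (s : ℕ → L.Term ℕ)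
    {S : VarSort → ℕ → ℕ → ExtType L} {P : VarSort → ℕ → ℕ → TmPred L C}
    (h : (pureModel Rels C).Valid Eqs S P) (t : Tm C) :
    t ∈ (pureModel Rels C).Sem Eqs A s S P := by
  induction A generalizing s S P t with
  | bot => trivial
  | rel n R _ => exact .inl hA
  | pvar k n i ts =>
    have := ((h.good k n i).cand (args fun j => (ts j).subst s)).2 hA
    change t ∈ P k n i _
    rw [this]
    trivial
  | imp A B _ ih => exact fun a _ _ => ih hA s h _
  | all₁ A ih => exact fun a => ih hA _ h t
  | all₂ k n A ih => exact fun G Q hG hQ => ih hA s (h.cons hG hQ) t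

theorem pureModel_sound (Rels : (n : ℕ) → L.Relations n → Prop) (C : Type) :
    (pureModel Rels C).Sound Eqs := by
  have hbot : HeadClosed (pureModel Rels C).bot := headClosed_univ
  have hrel : ∀ n R, HeadClosed ((pureModel Rels C).rel n R) := fun n R t t' h ht =>
    ht.imp_right (Tm.headClosed_pureRed t t' h)
  have hcand : ∀ k X, (pureModel Rels C).cand k X → HeadClosed X := fun k X h => h.1
  exact
    { admMap := admMap_extAdm
      bot_headClosed := hbot
      rel_headClosed := hrel
      cand_headClosed := hcand
      cand_sem := fun k G s S P hG h =>
        ⟨Model.sem_headClosed hbot hrel hcand G s h, fun hk =>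
          Set.eq_univ_of_forall (pureModel_sem_of_endsIn ((hG hk).endsIn Rels) s h)⟩
      syn_eqSubst := fun _ _ _ _ _ _ _ => trivial
      syn_typing := fun _ _ _ _ _ _ _ _ _ => trivial }

/-- Realizers of a `∀`-positive type reduce to pure terms, and neutral terms realize
the `∀`-negative types. -/
theorem pureModel_positive_negative (A : AF2Type L) (hbot : ¬ A.HasBot)
    (hrel : ∀ n (R : L.Relations n), A.HasRel R → ¬ Rels n R) (s : ℕ → L.Term ℕ)
    (S : VarSort → ℕ → ℕ → ExtType L) (P : VarSort → ℕ → ℕ → TmPred L C)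
    (hP : ∀ n i, A.HasFree₂ () n i → ∀ e, P .ordinary n i e = Tm.PureRed C) :
    (ForallPositive A → (pureModel Rels C).Sem Eqs A.toExt s S P ⊆ Tm.PureRed C) ∧
    (ForallNegative A → ∀ t, Tm.Neutral t → t ∈ (pureModel Rels C).Sem Eqs A.toExt s S P) := by
  induction A generalizing s S P with
  | bot => exact (hbot trivial).elim
  | rel n R ts =>
    refine ⟨fun _ t ht => ht.resolve_left (hrel n R rfl), fun _ t ht => .inr ht.mem_pureRed⟩
  | pvar k n i ts =>
    have : P .ordinary n i (args fun j => (ts j).subst s) = Tm.PureRed C :=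
      hP n i ⟨rfl, rfl, rfl⟩ _
    exact ⟨fun _ t ht => this.le ht, fun _ t ht => this.ge ht.mem_pureRed⟩
  | imp A B ihA ihB =>
    have hA := ihA (fun h => hbot (.inl h)) (fun n R h => hrel n R (.inl h)) s S P
      fun n i h => hP n i (.inl h)
    have hB := ihB (fun h => hbot (.inr h)) (fun n R h => hrel n R (.inr h)) s S P
      fun n i h => hP n i (.inr h)
    refine ⟨fun h t ht => ?_, fun h t ht a ha _ => ?_⟩
    · simp only [ForallPositive] at h
      exact Tm.pureRed_of_app_var
        (hB.1 h.2 (ht (Tm.var 0) (hA.2 h.1 _ (.var 0)) trivial))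
    · simp only [ForallNegative] at h
      exact hB.2 h.2 _ (.app ht (hA.1 h.1 ha))
  | all₁ A ih =>
    refine ⟨fun h t ht => ?_, fun h t ht a => ?_⟩
    · simp only [ForallPositive] at h
      exact (ih hbot hrel _ S P hP).1 h (ht (FirstOrder.Language.Term.var 0))
    · simp only [ForallNegative] at h
      exact (ih hbot hrel _ S P hP).2 h t ht
  | all₂ k n A ih =>
    -- the values of a variable other than the bound one
    have hne : ∀ (G : TmPred L C) m j, A.HasFree₂ () m j → (m = n → j ≠ 0) → ∀ e,
        consFam VarSort.ordinary n G P .ordinary m j e = Tm.PureRed C := by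
      intro G m j hj hmj e
      by_cases hm : m = n
      · cases j with
        | zero => exact (hmj hm rfl).elim
        | succ j =>
          simp only [consFam, hm, and_self, if_true]
          exact hP n j (by simpa [HasFree₂, hm] using hj) e
      · simp only [consFam, hm, and_false, if_false]
        exact hP m j (by simpa [HasFree₂, Ne.symm hm] using hj) e
    refine ⟨fun h t ht => ?_, fun h t ht G Q _ _ => ?_⟩
    · simp only [ForallPositive] at h
      refine (ih hbot hrel s (consFam VarSort.ordinary n Formula.bot S)
        (consFam VarSort.ordinary n (fun _ => Tm.PureRed C) P) ?_).1 h
        (ht .bot (fun _ => Tm.PureRed C) (fun h => nomatch h)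
          ⟨fun _ => ⟨Tm.headClosed_pureRed, fun h => nomatch h⟩, fun _ _ _ => rfl, fun _ _ _ => rfl⟩)
      intro m j hj e
      by_cases hmj : m = n ∧ j = 0
      · obtain ⟨rfl, rfl⟩ := hmj
        simp [consFam]
      · exact hne _ m j hj (fun h h' => hmj ⟨h, h'⟩) e
    · simp only [ForallNegative] at h
      refine (ih hbot hrel s (consFam VarSort.ordinary n G S)
        (consFam VarSort.ordinary n Q P) ?_).2 h.1 t ht
      intro m j hj e
      refine hne _ m j hj (fun h' h'' => h.2 ?_) e
      subst h' h''
      exact hj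

/-- Forgetting the sorts of the second order variables turns typings of `AF2_⊥` into typings
of `AF2`. -/
theorem TypingExt.toAF2 {t : Lam} {A : AF2Type L} (h : TypingExt Eqs [] t A.toExt) :
    TypingAF2 Eqs [] t A := by
  have hmap : AdmMap (ExtAdm (L := L)) (fun (_ : Unit) (_ : AF2Type L) => True) fun _ => () :=
    ⟨fun _ _ _ _ _ _ => trivial, fun _ _ _ => trivial, fun _ _ _ _ _ => trivial⟩
  have := Typing.act hmap h FirstOrder.Language.Term.var
    (S := fun _ n i => Formula.generic () n i) fun _ _ _ => trivial
  have hA : act FirstOrder.Language.Term.var (fun _ : VarSort => ())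
      (fun _ n i => Formula.generic () n i) A.toExt = A := by
    unfold AF2Type.toExt
    rw [mapSort_eq_act (fun _ _ _ => rfl), act_act]
    simp only [act_generic_shiftFam]
    conv_rhs => rw [← act_var_generic A]
    congr 1
  rwa [hA] at this

/-- A term of an ordinary `∀`-positive type, in a context of types which end with `⊥`, with special
variables or with symbols foreign to this type, is equivalent to a closed term of this type. -/
theorem exists_closed_typing {E : AF2Type L} (hclosed : E.Closed) (hpos : ForallPositive E)
    (hbot : ¬ E.HasBot) (hrel : ∀ n (R : L.Relations n), E.HasRel R → ¬ Rels n R)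
    {Γ : List (ExtType L)} (hΓ : ∀ B ∈ Γ, EndsIn Rels B) {t : Lam}
    (ht : TypingExt Eqs Γ t E.toExt) :
    ∃ v : Lam, Lam.BetaEq v t ∧ TypingAF2 Eqs [] v E := by
  have hvalid : (pureModel Rels ℕ).Valid Eqs (fun k n i => Formula.generic k n i)
      (fun _ _ _ _ => Set.univ) :=
    ⟨fun _ _ _ hk => hk, fun _ _ _ => ⟨fun _ => ⟨headClosed_univ, fun _ => rfl⟩,
      fun _ _ _ => rfl, fun _ _ _ => rfl⟩⟩
  have hmem := Model.adequacy (pureModel_sound Rels ℕ) ht FirstOrder.Language.Term.var hvalid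
    (σ := Tm.const) fun i B hB =>
      ⟨pureModel_sem_of_endsIn (hΓ B (List.mem_of_getElem? hB)) _ hvalid _, trivial⟩
  obtain ⟨v, hv⟩ := (pureModel_positive_negative E hbot hrel _ _ _
    fun n i h => (hclosed.2 () n i h).elim).1 hpos hmem
  -- the constants may be replaced by arbitrary terms
  have hred : ∀ g : ℕ → Lam, Relation.ReflTransGen Lam.BetaStep (Lam.subst g t) v := by
    intro g
    have := reflTransGen_map (Tm.eval g) (fun _ _ h => Tm.Step.eval h g) hv
    rwa [Tm.eval_subst_toTm, Tm.eval_toTm] at this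
  have htv := hred Lam.var
  rw [Lam.subst_var] at htv
  have hv' : TypingExt Eqs Γ v E.toExt := Typing.betaRed admMap_extAdm ht htv
  have hvc : v.Closed := by
    intro i hi
    -- a free variable of `v` lies in the context, and it lies outside when `t` is shifted
    have hlt := Typing.lt_length hv' hi
    have h := reflTransGen_map (Lam.toTm (C := ℕ)) (fun _ _ h => Tm.Step.toTm h)
      (hred fun j => .var (j + Γ.length))
    rw [Tm.toTm_subst] at h
    have hren : Tm.subst (fun i => (Lam.var (i + Γ.length)).toTm) t.toTm
        = Tm.rename (fun i => i + Γ.length) (t.toTm : Tm ℕ) := (Tm.rename_eq_subst _ _).symm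
    rw [hren] at h
    obtain ⟨w, _, hw⟩ := Tm.Red.of_rename h
    obtain ⟨w', rfl⟩ := Tm.exists_toTm_of_rename hw.symm
    rw [← Tm.toTm_rename] at hw
    rw [Tm.toTm_injective hw] at hi
    obtain ⟨j, hj⟩ := hi.of_rename
    omega
  exact ⟨v, (Relation.EqvGen.reflTransGen_le_eqvGen _ _ _ htv).symm _ _,
    TypingExt.toAF2 (hv'.of_closed hvc [])⟩

end StorageOp

namespace StorageOp

open Formula

/-! ### Families of terms -/

variable {L : FirstOrder.Language.{u, v}} {Eqs : Set (L.Term ℕ × L.Term ℕ)} {I : Type}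
  {Rels : (n : ℕ) → L.Relations n → Prop}

/-- The component of index `i` of a term whose constants are families of pure terms. -/
abbrev evalAt (i : I) (t : Tm (I → Lam)) : Lam := t.eval fun c => c i

theorem spineRed_evalAt (i : I) {t t' : Tm (I → Lam)} (h : Tm.SpineRed t t') :
    Relation.ReflTransGen Lam.SpineStep (evalAt i t) (evalAt i t') :=
  reflTransGen_map (evalAt i) (fun _ _ h => Tm.Spine.eval h _) h

/-- The sets of terms which depend only on the families of pure terms given by their elements, and
are closed under weak head expansion of these families, component by component. -/
def FamClosed (X : Set (Tm (I → Lam))) : Prop :=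
  ∀ t t', (∀ i, Relation.ReflTransGen Lam.SpineStep (evalAt i t) (evalAt i t')) → t' ∈ X → t ∈ X

theorem FamClosed.headClosed {X : Set (Tm (I → Lam))} (h : FamClosed X) : HeadClosed X :=
  fun t t' ht => h t t' fun _ => .single (ht.eval _)

theorem famClosed_univ : FamClosed (Set.univ : Set (Tm (I → Lam))) := fun _ _ _ _ => trivial

/-! ### The interpretation of the extended system -/

variable (Eqs) in
/-- The terms which arise from a term of type `A` in a context of types which end with `⊥`, with a
special variable or with a symbol in `Rels`, by replacing the variables by constants. -/
def ConstTyping (Rels : (n : ℕ) → L.Relations n → Prop) (A : ExtType L) (a : Tm (I → Lam)) :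
    Prop :=
  ∃ (Γ : List (ExtType L)) (t : Lam) (c : ℕ → I → Lam), (∀ B ∈ Γ, EndsIn Rels B) ∧
    TypingExt Eqs Γ t A ∧ a = Tm.subst (fun j => Tm.const (c j)) t.toTm

variable (Eqs) in
/-- In this interpretation, the argument of a realizer of `A → B` has to be typed, and the types
which end with `⊥`, with a special variable or with a symbol in `Rels` are interpreted by sets of
families of pure terms. The set `X` is the interpretation of `⊥`. -/
def famModel (Rels : (n : ℕ) → L.Relations n → Prop) (X : Set (Tm (I → Lam))) :
    Model L VarSort (I → Lam) where
  adm := ExtAdm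
  syn := ConstTyping Eqs Rels
  bot := X
  rel _ _ := Set.univ
  cand k Y := HeadClosed Y ∧ (k = VarSort.special → FamClosed Y)

variable {X : Set (Tm (I → Lam))}

theorem famModel_famClosed (hX : FamClosed X) {A : ExtType L} (hA : EndsIn Rels A)
    (s : ℕ → L.Term ℕ) {S : VarSort → ℕ → ℕ → ExtType L}
    {P : VarSort → ℕ → ℕ → TmPred L (I → Lam)} (h : (famModel Eqs Rels X).Valid Eqs S P) :
    FamClosed ((famModel Eqs Rels X).Sem Eqs A s S P) := by
  induction A generalizing s S P with
  | bot => exact hX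
  | rel n R _ => exact famClosed_univ
  | pvar k n i ts => exact ((h.good k n i).cand _).2 hA
  | imp A B _ ih =>
    intro t t' htt' ht' a ha hsyn
    exact ih hA s h _ _ (fun i => reflTransGen_map (fun u => Lam.app u (evalAt i a))
      (fun _ _ h => .app _ h) (htt' i)) (ht' a ha hsyn)
  | all₁ A ih => exact fun t t' htt' ht' a => ih hA _ h _ _ htt' (ht' a)
  | all₂ k n A ih =>
    exact fun t t' htt' ht' G Q hG hQ => ih hA s (h.cons hG hQ) _ _ htt' (ht' G Q hG hQ)

theorem EndsIn.act {A : ExtType L} (h : EndsIn Rels A) (s : ℕ → L.Term ℕ)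
    {S : VarSort → ℕ → ℕ → ExtType L} (hS : ∀ k n i, ExtAdm k (S k n i)) :
    EndsIn Rels (Formula.act s id S A) := by
  induction A generalizing s S with
  | bot => trivial
  | rel => exact h
  | pvar => exact (isBotType_substRen (hS _ _ _ h) _ _).endsIn Rels
  | imp A B _ ih => exact ih h s hS
  | all₁ A ih => exact ih h _ fun k n i hk => isBotType_substRen (hS k n i hk) _ _
  | all₂ k n A ih => exact ih h s (extAdm_upFam hS k n)

theorem EndsIn.constTyping {A : ExtType L} (h : EndsIn Rels A) (c : I → Lam) :
    ConstTyping Eqs Rels A (Tm.const c) :=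
  ⟨[A], .var 0, fun _ => c, by simpa using h, .var rfl, rfl⟩

/-- Finitely many terms typed up to constants have representations with a common context and a
common choice of constants. -/
theorem exists_common_context (Γ : List (ExtType L)) (σ : ℕ → Tm (I → Lam))
    (hσ : ∀ i B, Γ[i]? = some B → ConstTyping Eqs Rels B (σ i)) :
    ∃ (Δ : List (ExtType L)) (r : ℕ → Lam) (c : ℕ → I → Lam), (∀ B ∈ Δ, EndsIn Rels B) ∧
      ∀ i B, Γ[i]? = some B → TypingExt Eqs Δ (r i) B ∧
        σ i = Tm.subst (fun j => Tm.const (c j)) (r i).toTm := by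
  induction Γ generalizing σ with
  | nil => exact ⟨[], Lam.var, fun _ _ => .var 0, by simp, by simp⟩
  | cons A Γ ih =>
    obtain ⟨Δ, r, c, hΔ, hr⟩ := ih (fun i => σ (i + 1)) fun i B hB => hσ (i + 1) B hB
    obtain ⟨Δ', t, c', hΔ', ht, hσ0⟩ := hσ 0 A rfl
    refine ⟨Δ' ++ Δ, scons t fun i => Lam.rename (fun j => j + Δ'.length) (r i),
      fun j => if j < Δ'.length then c' j else c (j - Δ'.length), ?_, ?_⟩
    · intro B hB
      exact (List.mem_append.mp hB).elim (hΔ' B) (hΔ B)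
    · intro i B hB
      cases i with
      | zero =>
        cases hB
        refine ⟨?_, ?_⟩
        · have := Typing.rename ht (Γ' := Δ' ++ Δ) (ρ := fun i => i) fun i C _ hC => by
            rw [List.getElem?_append_left (List.getElem?_eq_some_iff.mp hC).1]
            exact hC
          have hid : Lam.rename (fun i => i) t = t := by
            have := Lam.subst_rename Lam.var (fun i => i) t
            rwa [Lam.subst_var, Lam.subst_var] at this
          rwa [hid] at this
        · rw [hσ0]
          refine Tm.subst_toTm_congr t fun i hi => ?_
          simp [Typing.lt_length ht hi]
      | succ i =>
        obtain ⟨h₁, h₂⟩ := hr i B hB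
        refine ⟨Typing.rename h₁ fun j C _ hC => ?_, ?_⟩
        · rw [List.getElem?_append_right (Nat.le_add_left _ _)]
          simpa using hC
        · rw [h₂]
          simp only [scons, Tm.toTm_rename, Tm.subst_rename]
          congr 1
          funext j
          simp

theorem famModel_sound (hX : FamClosed X) : (famModel Eqs Rels X).Sound Eqs := by
  have hrel : ∀ n R, HeadClosed ((famModel Eqs Rels X).rel n R) := fun _ _ => headClosed_univ
  have hcand : ∀ k Y, (famModel Eqs Rels X).cand k Y → HeadClosed Y := fun _ _ h => h.1
  exact
    { admMap := admMap_extAdm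
      bot_headClosed := hX.headClosed
      rel_headClosed := hrel
      cand_headClosed := hcand
      cand_sem := fun k G s S P hG h =>
        ⟨Model.sem_headClosed (M := famModel Eqs Rels X) hX.headClosed hrel hcand G s h,
          fun hk => famModel_famClosed hX ((hG hk).endsIn Rels) s h⟩
      syn_eqSubst := by
        rintro A s s' S a hs ⟨Γ, t, c, hΓ, ht, rfl⟩
        exact ⟨Γ, t, c, hΓ, Typing.eqSubst hs ht, rfl⟩
      syn_typing := by
        intro Γ t A s S σ ht hS hσ
        have ht' : TypingExt Eqs (Γ.map (act s id S)) t (act s id S A) :=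
          Typing.act admMap_extAdm ht s hS
        obtain ⟨Δ, r, c, hΔ, hr⟩ := exists_common_context (Γ.map (act s id S)) σ fun i B hB => by
          rw [List.getElem?_map, Option.map_eq_some_iff] at hB
          obtain ⟨B', hB', rfl⟩ := hB
          exact hσ i B' hB'
        refine ⟨Δ, Lam.subst r t, c, hΔ,
          Typing.subst admMap_extAdm ht' fun i B hB => (hr i B hB).1, ?_⟩
        rw [Tm.toTm_subst, Tm.subst_subst]
        refine Tm.subst_toTm_congr t fun i hi => ?_
        have hlt := Typing.lt_length ht' hi
        exact (hr i _ (List.getElem?_eq_getElem hlt)).2 }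

/-! ### The interpretation of `AF2` for the input type -/

/-- The terms `u` such that every family of terms equivalent to `u` belongs to `X`. -/
def ConvLift (X : Set (Tm (I → Lam))) : Set (Tm (I → Lam)) :=
  {u | ∀ θ : I → Tm (I → Lam), (∀ i, Tm.Conv (θ i) u) → Tm.const (fun i => evalAt i (θ i)) ∈ X}

theorem headClosed_convLift (X : Set (Tm (I → Lam))) : HeadClosed (ConvLift X) :=
  fun _ _ h hu θ hθ => hu θ fun i => (hθ i).trans _ _ _ (.rel _ _ h.step)

/-- An interpretation of `AF2` in the terms with families of pure terms as constants. -/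
def convModel (L : FirstOrder.Language.{u, v}) (X : Set (Tm (I → Lam))) :
    Model L Unit (I → Lam) where
  adm _ _ := True
  syn _ _ := True
  bot := ConvLift X
  rel _ _ := Set.univ
  cand _ Y := HeadClosed Y

theorem convModel_sound (X : Set (Tm (I → Lam))) : (convModel L X).Sound Eqs := by
  have hbot : HeadClosed (convModel L X).bot := headClosed_convLift X
  have hrel : ∀ n R, HeadClosed ((convModel L X).rel n R) := fun _ _ => headClosed_univ
  have hcand : ∀ k Y, (convModel L X).cand k Y → HeadClosed Y := fun _ _ h => h
  exact
    { admMap := ⟨fun _ _ _ _ _ _ => trivial, fun _ _ _ => trivial, fun _ _ _ _ _ => trivial⟩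
      bot_headClosed := hbot
      rel_headClosed := hrel
      cand_headClosed := hcand
      cand_sem := fun _ G s _ _ _ h => Model.sem_headClosed hbot hrel hcand G s h
      syn_eqSubst := fun _ _ _ _ _ _ _ => trivial
      syn_typing := fun _ _ _ _ _ _ _ _ _ => trivial }

theorem endsIn_perp (A : AF2Type L) (h : ∀ n (R : L.Relations n), A.HasRel R → Rels n R) :
    EndsIn Rels A.perp := by
  induction A with
  | bot => trivial
  | rel n R _ => exact h n R rfl
  | pvar => rfl
  | imp A B _ ih => exact ih fun n R h' => h n R (.inr h')
  | all₁ A ih => exact ih h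
  | all₂ k n A ih => exact ih h

/-- For a `∀`-positive type `A`, every family of terms equivalent to a realizer of `A` realizes
`A^⊥`. Conversely, a rigid term realizes a `∀`-negative type `A` as soon as all the families of terms
equivalent to it realize `A^⊥`. -/
theorem convModel_positive_negative (hX : FamClosed X) (A : AF2Type L)
    (hrel : ∀ n (R : L.Relations n), A.HasRel R → Rels n R) (s : ℕ → L.Term ℕ)
    {S : VarSort → ℕ → ℕ → ExtType L} {P : VarSort → ℕ → ℕ → TmPred L (I → Lam)}
    (h : (famModel Eqs Rels X).Valid Eqs S P) (S' : Unit → ℕ → ℕ → AF2Type L)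
    (P' : Unit → ℕ → ℕ → TmPred L (I → Lam))
    (hP : ∀ n i, A.HasFree₂ () n i → ∀ e, P' () n i e = ConvLift (P .special n i e)) :
    (ForallPositive A → (convModel L X).Sem Eqs A s S' P' ⊆
      ConvLift ((famModel Eqs Rels X).Sem Eqs A.perp s S P)) ∧
    (ForallNegative A → ∀ u, Tm.Rigid u →
      u ∈ ConvLift ((famModel Eqs Rels X).Sem Eqs A.perp s S P) →
      u ∈ (convModel L X).Sem Eqs A s S' P') := by
  induction A generalizing s S P S' P' with
  | bot => exact ⟨fun _ _ hu => hu, fun _ _ _ hu => hu⟩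
  | rel n R ts => exact ⟨fun _ _ _ _ _ => trivial, fun _ _ _ _ => trivial⟩
  | pvar k n i ts =>
    have := hP n i ⟨rfl, rfl, rfl⟩ (args fun j => (ts j).subst s)
    exact ⟨fun _ _ hu => this.le hu, fun _ _ _ hu => this.ge hu⟩
  | imp A B ihA ihB =>
    have hrelA : ∀ n (R : L.Relations n), A.HasRel R → Rels n R := fun n R h => hrel n R (.inl h)
    have hrelB : ∀ n (R : L.Relations n), B.HasRel R → Rels n R := fun n R h => hrel n R (.inr h)
    have hA := ihA hrelA s h S' P' fun n i h => hP n i (.inl h)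
    have hB := ihB hrelB s h S' P' fun n i h => hP n i (.inr h)
    have clA := famModel_famClosed (Eqs := Eqs) hX (endsIn_perp A hrelA) s h
    have clB := famModel_famClosed (Eqs := Eqs) hX (endsIn_perp B hrelB) s h
    refine ⟨fun hpos u hu θ hθ a ha _ => ?_, fun hneg u hru hu a ha _ => ?_⟩
    · simp only [ForallPositive] at hpos
      -- the family given by `a`, as a constant, is a realizer of `A` to which `u` can be applied
      let x : Tm (I → Lam) := Tm.const fun i => evalAt i a
      have hx : x ∈ ConvLift ((famModel Eqs Rels X).Sem Eqs (AF2Type.perp A) s S P) := by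
        intro θ' hθ'
        refine clA _ a (fun i => ?_) ha
        have hi := spineRed_evalAt i (hθ' i).spineRed_const
        exact hi
      have hux := hB.1 hpos.2 (hu x (hA.2 hpos.1 x (.const _) hx) trivial)
      exact clB _ (Tm.const fun i => evalAt i (Tm.app (θ i) x)) (fun i => .refl) (hux (fun i => Tm.app (θ i) x) fun i => (hθ i).appLeft x)
    · simp only [ForallNegative] at hneg
      refine hB.2 hneg.2 _ (.app a hru) fun θ hθ => ?_
      choose θ₁ θ₂ hθ₀ hθ₁ hθ₂ using fun i => hru.conv_app (hθ i)
      have hsyn : ConstTyping Eqs Rels (act s id S (AF2Type.perp A))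
          (Tm.const fun i => evalAt i (θ₂ i)) :=
        ((endsIn_perp A hrelA).act s h.adm).constTyping _
      refine clB _ _ (fun i => ?_) (hu θ₁ hθ₁ _ (hA.1 hneg.1 ha θ₂ hθ₂) hsyn)
      have hi := spineRed_evalAt i (hθ₀ i)
      exact hi
  | all₁ A ih =>
    refine ⟨fun hpos u hu θ hθ a => ?_, fun hneg u hru hu a => ?_⟩
    · simp only [ForallPositive] at hpos
      exact (ih hrel _ h S' P' hP).1 hpos (hu a) θ hθ
    · simp only [ForallNegative] at hneg
      exact (ih hrel _ h S' P' hP).2 hneg u hru fun θ hθ => hu θ hθ a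
  | all₂ k n A ih =>
    -- the values of a variable other than the bound one
    have hne : ∀ (Q Q' : TmPred L (I → Lam)) m j, A.HasFree₂ () m j → (m = n → j ≠ 0) → ∀ e,
        consFam k n Q' P' () m j e = ConvLift (consFam VarSort.special n Q P .special m j e) := by
      intro Q Q' m j hj hmj e
      by_cases hm : m = n
      · cases j with
        | zero => exact (hmj hm rfl).elim
        | succ j =>
          simp only [consFam, hm, and_self, if_true]
          exact hP n j (by simpa [HasFree₂, hm] using hj) e
      · simp only [consFam, hm, and_false, if_false]
        exact hP m j (by simpa [HasFree₂, Ne.symm hm] using hj) e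
    refine ⟨fun hpos u hu θ hθ G Q hG hQ => ?_, fun hneg u hru hu G' Q' _ _ => ?_⟩
    · simp only [ForallPositive] at hpos
      refine (ih hrel s (h.cons hG hQ) (consFam k n .bot S')
        (consFam k n (fun e => ConvLift (Q e)) P') ?_).1 hpos (hu .bot _ trivial
          ⟨fun _ => headClosed_convLift _, fun e e' he => congrArg ConvLift (hQ.arity e e' he),
            fun e e' he => congrArg ConvLift (hQ.eqSubst e e' he)⟩) θ hθ
      intro m j hj e
      by_cases hmj : m = n ∧ j = 0
      · obtain ⟨rfl, rfl⟩ := hmj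
        simp [consFam]
      · exact hne _ _ m j hj (fun h h' => hmj ⟨h, h'⟩) e
    · simp only [ForallNegative] at hneg
      have hG : (famModel Eqs Rels X).adm VarSort.special Formula.bot := fun _ => trivial
      have hQ : (famModel Eqs Rels X).Good Eqs VarSort.special n fun _ => Set.univ :=
        ⟨fun _ => ⟨headClosed_univ, fun _ => famClosed_univ⟩, fun _ _ _ => rfl, fun _ _ _ => rfl⟩
      refine (ih hrel s (h.cons hG hQ) (consFam k n G' S') (consFam k n Q' P') ?_).2 hneg.1 u hru
        fun θ hθ => hu θ hθ _ _ hG hQ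
      intro m j hj e
      refine hne _ _ m j hj (fun h' h'' => hneg.2 ?_) e
      subst h' h''
      exact hj

/-- The families of terms equivalent to a term of a closed `∀`-positive type `D` of `AF2` realize
`D^⊥`. -/
theorem famModel_mem_perp (hX : FamClosed X) {D : AF2Type L} (hclosed : D.Closed)
    (hpos : ForallPositive D) (hrel : ∀ n (R : L.Relations n), D.HasRel R → Rels n R)
    (s : ℕ → L.Term ℕ) {S : VarSort → ℕ → ℕ → ExtType L}
    {P : VarSort → ℕ → ℕ → TmPred L (I → Lam)} (h : (famModel Eqs Rels X).Valid Eqs S P)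
    {t : Lam} (ht : TypingAF2 Eqs [] t D) {θ : I → Lam} (hθ : ∀ i, Lam.BetaEq (θ i) t) :
    Tm.const θ ∈ (famModel Eqs Rels X).Sem Eqs D.perp s S P := by
  have hmem := Model.adequacy (convModel_sound X) (t := t) (A := D) (Γ := []) ht s
    (S := fun _ _ _ => .bot) (P := fun _ _ _ _ => Set.univ)
    ⟨fun _ _ _ => trivial, fun _ _ _ => ⟨fun _ => headClosed_univ, fun _ _ _ => rfl,
      fun _ _ _ => rfl⟩⟩ (σ := Tm.var) (by simp)
  rw [Tm.subst_var] at hmem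
  have := (convModel_positive_negative hX D hrel s h _ _
    fun n i hi => (hclosed.2 () n i hi).elim).1 hpos hmem (fun i => (θ i).toTm)
    fun i => Tm.Conv.toTm (hθ i)
  simpa only [evalAt, Tm.eval_toTm] using this

end StorageOp

namespace StorageOp

open Formula

/-! ### Storage operators -/

theorem TypingExt.isStorageOperator {L : FirstOrder.Language.{u, v}}
    {Eqs : Set (L.Term ℕ × L.Term ℕ)} {D E : AF2Type L} (hDclosed : D.Closed)
    (hEclosed : E.Closed) (hDpos : ForallPositive D) (hEpos : ForallPositive E)
    (hEbot : ¬ E.HasBot)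
    (hsymb : ∀ (n : ℕ) (R : L.Relations n), ¬ (D.HasRel R ∧ E.HasRel R)) {T : Lam}
    (hT : TypingExt Eqs [] T (.imp D.perp E.toExt.neg.neg)) :
    IsStorageOperator Eqs T D E := by
  refine ⟨fun i hi => absurd (Typing.lt_length hT hi) (Nat.not_lt_zero i), fun t ht => ?_⟩
  -- the terms `θ` and the variables `f`, all at once
  let I : Type := {p : Lam × ℕ // Lam.BetaEq p.1 t}
  let X : Set (Tm (I → Lam)) := {u | ∃ τ τ' : Lam, Lam.BetaEq τ' τ ∧ TypingAF2 Eqs [] τ' E ∧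
    ∀ i : I, ∃ σ : ℕ → Lam, Relation.ReflTransGen Lam.SpineStep (evalAt i u)
      (.app (.var i.1.2) (Lam.subst σ τ))}
  have hX : FamClosed X := by
    rintro u u' huu' ⟨τ, τ', h₁, h₂, h₃⟩
    refine ⟨τ, τ', h₁, h₂, fun i => ?_⟩
    obtain ⟨σ, hσ⟩ := h₃ i
    exact ⟨σ, (huu' i).trans hσ⟩
  let Rels : (n : ℕ) → L.Relations n → Prop := fun n R => D.HasRel R
  let S : VarSort → ℕ → ℕ → ExtType L := fun k n i => Formula.generic k n i
  let P : VarSort → ℕ → ℕ → TmPred L (I → Lam) := fun _ _ _ _ => Set.univ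
  have hvalid : (famModel Eqs Rels X).Valid Eqs S P :=
    ⟨fun _ _ _ hk => hk, fun _ _ _ => ⟨fun _ => ⟨headClosed_univ, fun _ => famClosed_univ⟩,
      fun _ _ _ => rfl, fun _ _ _ => rfl⟩⟩
  let s : ℕ → L.Term ℕ := FirstOrder.Language.Term.var
  have hTmem := Model.adequacy (famModel_sound hX) hT s hvalid (σ := Tm.var) (by simp)
  rw [Tm.subst_var] at hTmem
  have hθ : Tm.const (fun i : I => i.1.1) ∈ (famModel Eqs Rels X).Sem Eqs D.perp s S P :=
    famModel_mem_perp hX hDclosed hDpos (fun _ _ h => h) s hvalid ht fun i => i.2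
  have hθsyn : ConstTyping Eqs Rels (Formula.act s id S D.perp)
      (Tm.const fun i : I => i.1.1) :=
    ((endsIn_perp D fun _ _ h => h).act s hvalid.adm).constTyping _
  have hf : Tm.const (fun i : I => Lam.var i.1.2) ∈
      (famModel Eqs Rels X).Sem Eqs E.toExt.neg s S P := by
    rintro e _ ⟨Γ, τ, c, hΓ, hτ, rfl⟩
    have hE : Formula.act s id S E.toExt = E.toExt := Formula.act_var_generic _
    rw [hE] at hτ
    -- the uniform term is `τ`; its variables stand for the families `c`
    obtain ⟨τ', h₁, h₂⟩ := exists_closed_typing hEclosed hEpos hEbot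
      (fun n R hER hDR => hsymb n R ⟨hDR, hER⟩) hΓ hτ
    refine ⟨τ, τ', h₁, h₂, fun i => ⟨fun j => c j i, ?_⟩⟩
    simp only [evalAt, Tm.eval, Tm.eval_subst_toTm]
    exact .refl
  have hfsyn : ConstTyping Eqs Rels (Formula.act s id S E.toExt.neg)
      (Tm.const fun i : I => Lam.var i.1.2) :=
    EndsIn.constTyping (EndsIn.act (A := E.toExt.neg) trivial s hvalid.adm) _
  obtain ⟨τ, τ', h₁, h₂, h₃⟩ := hTmem _ hθ hθsyn _ hf hfsyn
  refine ⟨τ, τ', h₁, h₂, fun θ hθt f _ => ?_⟩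
  obtain ⟨σ, hσ⟩ := h₃ ⟨(θ, f), hθt⟩
  simp only [evalAt, Tm.eval, Tm.eval_toTm] at hσ
  exact ⟨σ, reflTransGen_map id (fun _ _ h => .spine h) hσ⟩

end StorageOp

theorem theorem6p1 {L : FirstOrder.Language.{u, v}} (Eqs : Set (L.Term ℕ × L.Term ℕ))
    (D E : StorageOp.AF2Type L) (hDclosed : D.Closed) (hEclosed : E.Closed)
    (hDpos : StorageOp.ForallPositive D) (hEpos : StorageOp.ForallPositive E)
    (hEbot : ¬ E.HasBot)
    (hsymb : ∀ (n : ℕ) (R : L.Relations n), ¬ (D.HasRel R ∧ E.HasRel R))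
    (T : StorageOp.Lam)
    (hT : StorageOp.TypingExt Eqs [] T (.imp D.perp E.toExt.neg.neg)) :
    StorageOp.IsStorageOperator Eqs T D E :=
  hT.isStorageOperator hDclosed hEclosed hDpos hEpos hEbot hsymb
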